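/- **Setting.** Let $D\ge 0$ and let $\Omega$ be the system of finitely many linear inequalities $\alpha_i\cdot b\ge c_i$ ($i\in I$) on $b\in\mathbb R^D$, with $\alpha_i\in\mathbb R^D$, $c_i\in\{1,0,-1\}$ and $I_c=\{i\in I: c_i=c\}$. Write $\langle\alpha,c\rangle$ for the inequality $\alpha\cdot b\ge c$, and $\mathrm{sat}(\Omega)$ for the solution set. Assume that $\alpha_i=0$ for some $i\in I_{-1}$ (a trivial inequality, added without loss of generality), that $\alpha_i\ne0$ for all $i\in I_0$, and that $\Omega$ is non-degenerate: $\mathrm{sat}(\Omega)$ is non-empty and its affine span has dimension $D$. A representation of $\Omega$ is a finite set of inequalities $\langle\alpha,c\rangle$ ($c\in\{1,0,-1\}$) with solution set $\mathrm{sat}(\Omega)$; it is minimal if it has the least possible number of elements. Two inequalities agree up to normalisation if $(\alpha',c')=(t\alpha,tc)$ for some $t>0$. For $s=\pm1$ and an integer $p>1$ put $$\mathrm{reg}_s(\Omega)=\Big\{\sum_{i\in I}\lambda_i\alpha_i:\ \lambda_i\ge0,\ \sum_{i\in I}\lambda_ic_i\ge s\Big\},$$ $$P_s=\{\alpha_i: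 i\in I_s\},\quad Z^{(p)}_s=\{\alpha_i+(p-1)\alpha_j: i\in I_s,\,j\in I_0\},\quad N^{(p)}_s=\{p\alpha_i+(p-1)\alpha_j: i\in I_s,\,j\in I_{-s}\},$$ $$H^{(p)}_s=\mathrm{conv}\big(P_s\cup Z^{(p)}_s\cup N^{(p)}_s\big).$$ A $K$-face of a convex set $C$ is a non-empty convex $F\subseteq C$ with affine span of dimension $K$ such that whenever $\mu\eta_1+(1-\mu)\eta_2\in F$ with $\eta_1,\eta_2\in C$ and $\mu\in(0,1)$, also $\eta_1,\eta_2\in F$. Extreme points are $0$-faces and edges are $1$-faces. **Statement.** $\Omega$ has a minimal representation $\mathrm{rel}(\Omega)$; it is unique up to normalisation, and each of its elements is, up to normalisation, one of the $\langle\alpha_i,c_i\rangle$. Membership in $\mathrm{rel}(\Omega)$ being understood up to normalisation, it is determined as follows. 1. $\langle 0,-1\rangle\notin\mathrm{rel}(\Omega)$. For $s=\pm1$ and $i\in I_s$ with $\langle\alpha_i,s\rangle\neq\langle 0,-1\rangle$, the following are equivalent: $\langle\alpha_i,s\rangle\in\mathrm{rel}(\Omega)$; $\alpha_i$ is an extreme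 point of $\mathrm{reg}_s(\Omega)$; $\alpha_i$ is an extreme point of $H^{(p)}_s$ for some integer $p>1$; $\alpha_i$ is an extreme point of $H^{(p)}_s$ for every integer $p>1$. 2. Let $j\in I_0$, let $s=\pm1$ with $I_s\ne\emptyset$, and let $p>1$ be any integer. (a) $\langle\alpha_j,0\rangle\in\mathrm{rel}(\Omega)$ if and only if for some $i\in I_s$ the ray $\{\alpha_i+\lambda\alpha_j:\lambda\ge0\}$ is an edge of $\mathrm{reg}_s(\Omega)$ that contains no point of $N^{(p)}_s$. (b) Call $\alpha_j$ longest if $|\alpha_k|\le|\alpha_j|$ for all $k\in I_0$ such that $\alpha_k$ is a positive multiple of $\alpha_j$. Then $\langle\alpha_j,0\rangle\in\mathrm{rel}(\Omega)$ and $\alpha_j$ is longest if and only if there are $i,k\in I_s$ with $\alpha_k\in\{\alpha_i+\lambda\alpha_j:\lambda\ge0\}$ such that the segment between $\alpha_i$ and $\alpha_k+(p-1)\alpha_j$ is an edge of $H^{(p)}_s$ that contains no point of $N^{(p)}_s$. (c) If there are no $i,k\in I_s$ and $\lambda>0$ with $\alpha_k=\alpha_i+\lambda\alpha_j$, one may take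 $k=i$ in (b): $\langle\alpha_j,0\rangle\in\mathrm{rel}(\Omega)$ and $\alpha_j$ is longest if and only if for some $i\in I_s$ the segment between $\alpha_i$ and $\alpha_i+(p-1)\alpha_j$ is an edge of $H^{(p)}_s$ that contains no point of $N^{(p)}_s$. -/

import Mathlib

/-- A linear constraint `vec · b ≥ off` on `b ∈ ℝ^D`, with `off ∈ {-1, 0, 1}`. -/
structure LinConstr (D : ℕ) where
  vec : EuclideanSpace ℝ (Fin D)
  off : SignType

/-- Equality of two linear constraints up to normalisation: `(α', c') = (t α, t c)`, `t > 0`. -/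
def LinConstr.NormEquiv {D : ℕ} (x y : LinConstr D) : Prop :=
  ∃ t : ℝ, 0 < t ∧ y.vec = t • x.vec ∧ (y.off : ℝ) = t * (x.off : ℝ)

/-- The points satisfying every linear constraint in the finite set `S`. -/
def satSet {D : ℕ} (S : Finset (LinConstr D)) : Set (EuclideanSpace ℝ (Fin D)) :=
  {b | ∀ x ∈ S, (x.off : ℝ) ≤ inner ℝ x.vec b}

/-- The points satisfying the constraint `Ω` given by all `α i · b ≥ c i`. -/
def sat {D : ℕ} {ι : Type*} (α : ι → EuclideanSpace ℝ (Fin D)) (c : ι → SignType) :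
    Set (EuclideanSpace ℝ (Fin D)) :=
  {b | ∀ i, (c i : ℝ) ≤ inner ℝ (α i) b}

/-- `S` is a representation of `Ω` with the smallest possible number of elements. -/
def IsMinRep {D : ℕ} {ι : Type*} (α : ι → EuclideanSpace ℝ (Fin D)) (c : ι → SignType)
    (S : Finset (LinConstr D)) : Prop :=
  satSet S = sat α c ∧ ∀ T : Finset (LinConstr D), satSet T = sat α c → S.card ≤ T.card

/-- `x` belongs to the set of constraints `S` up to normalisation. -/
def MemNorm {D : ℕ} (x : LinConstr D) (S : Finset (LinConstr D)) : Prop :=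
  ∃ y ∈ S, x.NormEquiv y

/-- The dimension of the affine span of a set. -/
noncomputable def setDim {D : ℕ} (X : Set (EuclideanSpace ℝ (Fin D))) : ℕ :=
  Module.finrank ℝ (affineSpan ℝ X).direction

/-- `Ω` is satisfiable and its solution set is full-dimensional
(it is not contained in a hyperplane). -/
def NonDegenerate {D : ℕ} {ι : Type*} (α : ι → EuclideanSpace ℝ (Fin D)) (c : ι → SignType) :
    Prop :=
  (sat α c).Nonempty ∧ setDim (sat α c) = D

/-- `F` is a `K`-face of `C`. -/
def IsKFace {D : ℕ} (C : Set (EuclideanSpace ℝ (Fin D))) (K : ℕ)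
    (F : Set (EuclideanSpace ℝ (Fin D))) : Prop :=
  F.Nonempty ∧ Convex ℝ F ∧ IsExtreme ℝ C F ∧ setDim F = K

/-- `F` is an edge of `C`, i.e. a `1`-face. -/
def IsEdge {D : ℕ} (C F : Set (EuclideanSpace ℝ (Fin D))) : Prop := IsKFace C 1 F

/-- The region `reg_s(Ω)`. -/
def reg {D : ℕ} {ι : Type*} [Fintype ι] (α : ι → EuclideanSpace ℝ (Fin D)) (c : ι → SignType)
    (s : SignType) : Set (EuclideanSpace ℝ (Fin D)) :=
  {β | ∃ l : ι → ℝ, (∀ i, 0 ≤ l i) ∧ (s : ℝ) ≤ ∑ i, l i * (c i : ℝ) ∧ β = ∑ i, l i • α i}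

/-- The points `α i` with `c i = s`. -/
def ptsP {D : ℕ} {ι : Type*} (α : ι → EuclideanSpace ℝ (Fin D)) (c : ι → SignType)
    (s : SignType) : Set (EuclideanSpace ℝ (Fin D)) :=
  {β | ∃ i, c i = s ∧ β = α i}

/-- The points `α i + (p - 1) α j` with `c i = s`, `c j = 0`. -/
def ptsZ {D : ℕ} {ι : Type*} (α : ι → EuclideanSpace ℝ (Fin D)) (c : ι → SignType)
    (s : SignType) (p : ℕ) : Set (EuclideanSpace ℝ (Fin D)) :=
  {β | ∃ i j, c i = s ∧ c j = 0 ∧ β = α i + ((p : ℝ) - 1) • α j}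

/-- The points `p α i + (p - 1) α j` with `c i = s`, `c j = -s`. -/
def ptsN {D : ℕ} {ι : Type*} (α : ι → EuclideanSpace ℝ (Fin D)) (c : ι → SignType)
    (s : SignType) (p : ℕ) : Set (EuclideanSpace ℝ (Fin D)) :=
  {β | ∃ i j, c i = s ∧ c j = -s ∧ β = (p : ℝ) • α i + ((p : ℝ) - 1) • α j}

/-- The polytope `H^(p)_s(Ω)`. -/
def hullH {D : ℕ} {ι : Type*} (α : ι → EuclideanSpace ℝ (Fin D)) (c : ι → SignType)
    (s : SignType) (p : ℕ) : Set (EuclideanSpace ℝ (Fin D)) :=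
  convexHull ℝ (ptsP α c s ∪ ptsZ α c s p ∪ ptsN α c s p)

/-- The ray from `x` in direction `v`. -/
def rayFrom {D : ℕ} (x v : EuclideanSpace ℝ (Fin D)) : Set (EuclideanSpace ℝ (Fin D)) :=
  {β | ∃ l : ℝ, 0 ≤ l ∧ β = x + l • v}

/-- `α j` is longest among the vectors of the homogeneous constraints that are equivalent to
the `j`-th one. -/
def IsLongest {D : ℕ} {ι : Type*} (α : ι → EuclideanSpace ℝ (Fin D)) (c : ι → SignType)
    (j : ι) : Prop :=
  ∀ k, c k = 0 → (∃ r : ℝ, 0 < r ∧ α k = r • α j) → ‖α k‖ ≤ ‖α j‖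

/-! The inequalities `c ≤ α · b` valid on `sat α c` form a cone in `ℝ^D × ℝ`. By Farkas' lemma it is
generated by the pairs `(α i, c i)`; the trivial pair `(0, -1)` supplies the slack in the constant
term. At an interior point of `sat α c` every nonzero valid inequality is strict, so the cone is
pointed and is generated by its extreme rays. A representation together with `(0, -1)` also
generates the cone, hence meets every extreme ray other than the trivial one; conversely, one
inequality from each such ray is enough. Minimal representations are therefore exactly the choices
of one inequality per nontrivial extreme ray (`IsEssential`, `IsMinRep.memNorm_iff`), and the rest
of the theorem detects extreme rays.

For this, `reg α c s` is the slice of the cone at height `s` (`mem_reg_iff`). An extreme ray of sign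
`s` meets the slice in an extreme point. Seen from a point `α i` with `c i = s`, the `k`-th
generator moves within the slice in the direction `α k - s (c k) α i`, and `hullH` contains a point
at a positive distance along it (`neighbour`). An extreme set that reaches from `α i` along a
nonnegative combination of such directions contains all the neighbours involved
(`neighbour_mem_of_isExtreme`). This serves `reg` and `hullH` alike, and all `p > 1` at once.

A homogeneous extreme ray has height `0` and appears in the slice as the direction of an edge.
Dividing by its line leaves a pointed cone, and an extreme generator of sign `s` of that cone yields
a two-dimensional face (`IsEssential.exists_spansFace`), whose slice is a ray. Conversely, an edge
in direction `α j` could also arise from generators of signs `s` and `-s` whose heights cancel;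
avoiding `ptsN` rules this out, since the neighbours of sign `-s` lie there. -/

/-! ### Extreme generators of finitely generated pointed cones -/

/-- A finite pointed family has a subfamily generating the same cone whose members span pairwise
different extreme rays of that cone. -/
theorem exists_extreme_generators {W ι : Type*} [AddCommGroup W] [Module ℝ W]
    (v : ι → W) (A : Finset ι)
    (hpt : ∀ l : ι → ℝ, (∀ i, 0 ≤ l i) → ∑ i ∈ A, l i • v i = 0 → ∀ i ∈ A, l i = 0) :
    ∃ B ⊆ A, (∀ a ∈ A, ∃ l : ι → ℝ, (∀ i, 0 ≤ l i) ∧ v a = ∑ i ∈ B, l i • v i) ∧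
      (∀ b ∈ B, ∀ l : ι → ℝ, (∀ i, 0 ≤ l i) → v b = ∑ i ∈ A, l i • v i →
        ∀ k ∈ A, 0 < l k → ∃ t : ℝ, 0 < t ∧ v k = t • v b) ∧
      (∀ b ∈ B, ∀ b' ∈ B, ∀ t : ℝ, 0 < t → v b' = t • v b → b = b') := by
  classical
  obtain ⟨B, ⟨hBA, hgen⟩, hmin⟩ := exists_minimal_of_wellFoundedLT
    (fun B : Finset ι => B ⊆ A ∧
      ∀ a ∈ A, ∃ l : ι → ℝ, (∀ i, 0 ≤ l i) ∧ v a = ∑ i ∈ B, l i • v i)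
    ⟨A, subset_rfl, fun a ha => ⟨Pi.single a 1, fun i => by
      by_cases h : i = a
      · subst h; simp
      · simp [h], by simp [Pi.single_apply, ha]⟩⟩
  have hirr : ∀ b ∈ B, ∀ l : ι → ℝ, (∀ i, 0 ≤ l i) → v b ≠ ∑ i ∈ B.erase b, l i • v i := by
    intro b hb l hl hvb
    have hle : B ≤ B.erase b := by
      refine hmin ⟨(Finset.erase_subset _ _).trans hBA, fun a ha => ?_⟩ (Finset.erase_subset _ _)
      obtain ⟨m, hm, hma⟩ := hgen a ha
      refine ⟨fun i => m b * l i + m i,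
        fun i => add_nonneg (mul_nonneg (hm b) (hl i)) (hm i), ?_⟩
      rw [hma, ← Finset.add_sum_erase _ _ hb, hvb, Finset.smul_sum, ← Finset.sum_add_distrib]
      exact Finset.sum_congr rfl fun i _ => by rw [add_smul, mul_smul]
    exact Finset.notMem_erase b B (hle hb)
  refine ⟨B, hBA, hgen, fun b hb l hl hvb k hk hlk => ?_, fun b hb b' hb' t ht hbb' => ?_⟩
  · choose! m hm hmv using hgen
    set r : ι → ℝ := fun j => ∑ i ∈ A, l i * m i j with hr
    have hr0 : ∀ j, 0 ≤ r j := fun j =>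
      Finset.sum_nonneg fun i hi => mul_nonneg (hl i) (hm i hi j)
    have hsum : v b = ∑ j ∈ B, r j • v j := by
      rw [hvb]
      simp only [hr, Finset.sum_smul]
      rw [Finset.sum_comm]
      refine Finset.sum_congr rfl fun i hi => ?_
      conv_lhs => rw [hmv i hi, Finset.smul_sum]
      exact Finset.sum_congr rfl fun j _ => by rw [mul_smul]
    rw [← Finset.add_sum_erase _ _ hb] at hsum
    -- If the coefficient of `v b` on the right were below `1`, solving for `v b` would make `b`
    -- redundant in the minimal family `B`.
    have hge : 1 ≤ r b := by
      by_contra hlt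
      have hpos : 0 < 1 - r b := by linarith
      refine hirr b hb (fun j => (1 - r b)⁻¹ * r j)
        (fun j => mul_nonneg (inv_nonneg.2 hpos.le) (hr0 j)) ?_
      simp only [mul_smul]
      rw [← Finset.smul_sum, eq_inv_smul_iff₀ hpos.ne', sub_smul, one_smul]
      exact sub_eq_of_eq_add' hsum
    -- Moving `v b` to the right leaves a vanishing combination with coefficients `r b - 1 ≥ 0` and
    -- `r j ≥ 0`, so pointedness applies.
    have hzero : ∀ j ∈ B.erase b, r j = 0 := by
      have h := hpt (fun j => if j = b then r b - 1 else if j ∈ B then r j else 0)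
        (fun j => by
          split_ifs
          · linarith
          · exact hr0 j
          · exact le_rfl)
        (by
          rw [← Finset.sum_subset hBA (fun j _ hj => by
              have : j ≠ b := fun h => hj (h ▸ hb)
              simp [this, hj]),
            ← Finset.add_sum_erase _ _ hb]
          have : ∑ j ∈ B.erase b, (if j = b then r b - 1 else if j ∈ B then r j else 0) • v j
              = ∑ j ∈ B.erase b, r j • v j :=
            Finset.sum_congr rfl fun j hj => by
              rw [if_neg (Finset.ne_of_mem_erase hj), if_pos (Finset.mem_of_mem_erase hj)]
          rw [this, if_pos rfl, sub_smul, one_smul, sub_add_eq_add_sub, ← hsum, sub_self])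
      intro j hj
      have := h j (hBA (Finset.mem_of_mem_erase hj))
      rwa [if_neg (Finset.ne_of_mem_erase hj), if_pos (Finset.mem_of_mem_erase hj)] at this
    have hvk : v k = m k b • v b := by
      rw [hmv k hk, ← Finset.add_sum_erase _ _ hb, Finset.sum_eq_zero, add_zero]
      intro j hj
      have h0 := (Finset.sum_eq_zero_iff_of_nonneg
        fun i hi => mul_nonneg (hl i) (hm i hi j)).1 (hzero j hj) k hk
      rw [(mul_eq_zero.1 h0).resolve_left hlk.ne', zero_smul]
    refine ⟨m k b, lt_of_le_of_ne (hm k hk b) fun h0 => ?_, hvk⟩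
    rw [← h0, zero_smul] at hvk
    have h1 := hpt (fun i => if i = k then 1 else 0)
      (fun i => by split_ifs <;> norm_num) (by simp [hk, hvk]) k hk
    simp at h1
  · by_contra hne
    refine hirr b' hb' (fun i => if i = b then t else 0)
      (fun i => by split_ifs <;> linarith) ?_
    simp [hne, hb, hbb']

/-! ### The cone of valid inequalities and Farkas' lemma -/

/-- The inhomogeneous inequalities `x.2 ≤ x.1 · b` that are valid on `X`. -/
def validCone {D : ℕ} (X : Set (EuclideanSpace ℝ (Fin D))) :
    Set (EuclideanSpace ℝ (Fin D) × ℝ) :=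
  {x | ∀ b ∈ X, x.2 ≤ inner ℝ x.1 b}

section validCone

variable {D : ℕ} {X : Set (EuclideanSpace ℝ (Fin D))}

theorem zero_mem_validCone : (0 : EuclideanSpace ℝ (Fin D) × ℝ) ∈ validCone X :=
  fun b _ => by simp

theorem add_mem_validCone {x y : EuclideanSpace ℝ (Fin D) × ℝ} (hx : x ∈ validCone X)
    (hy : y ∈ validCone X) : x + y ∈ validCone X := fun b hb => by
  simpa [inner_add_left] using add_le_add (hx b hb) (hy b hb)

theorem smul_mem_validCone {x : EuclideanSpace ℝ (Fin D) × ℝ} (hx : x ∈ validCone X) {t : ℝ}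
    (ht : 0 ≤ t) : t • x ∈ validCone X := fun b hb => by
  simpa [inner_smul_left] using mul_le_mul_of_nonneg_left (hx b hb) ht

theorem sum_mem_validCone {κ : Type*} (s : Finset κ) (v : κ → EuclideanSpace ℝ (Fin D) × ℝ)
    (h : ∀ k ∈ s, v k ∈ validCone X) : ∑ k ∈ s, v k ∈ validCone X :=
  Finset.sum_induction v (· ∈ validCone X) (fun _ _ => add_mem_validCone) zero_mem_validCone h

/-- Valid nontrivial inequalities are strict in the interior. -/
theorem lt_inner_of_mem_interior {b₀ : EuclideanSpace ℝ (Fin D)} (hb₀ : b₀ ∈ interior X)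
    {x : EuclideanSpace ℝ (Fin D) × ℝ} (hx : x ∈ validCone X) (hx0 : x ≠ 0) :
    x.2 < inner ℝ x.1 b₀ := by
  by_cases h1 : x.1 = 0
  · have h := hx b₀ (interior_subset hb₀)
    refine lt_of_le_of_ne h fun h2 => hx0 ?_
    rw [h1, inner_zero_left] at h2
    exact Prod.ext h1 h2
  · have hc : ContinuousAt (fun e : ℝ => b₀ - e • x.1) 0 := by fun_prop
    have hev : ∀ᶠ e : ℝ in nhds 0, b₀ - e • x.1 ∈ X :=
      hc.eventually (by simpa using mem_interior_iff_mem_nhds.1 hb₀)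
    obtain ⟨d, hd, hball⟩ := Metric.eventually_nhds_iff.1 hev
    have h := hx _ (hball (y := d / 2) (by simp [abs_of_pos hd, hd]))
    rw [inner_sub_right, inner_smul_right, real_inner_self_eq_norm_sq] at h
    have : 0 < d / 2 * ‖x.1‖ ^ 2 := by positivity
    linarith

end validCone

theorem convex_sat {D : ℕ} {ι : Type*} (α : ι → EuclideanSpace ℝ (Fin D)) (c : ι → SignType) :
    Convex ℝ (sat α c) := by
  intro x hx y hy a b ha hb hab i
  have h1 := mul_le_mul_of_nonneg_left (hx i) ha
  have h2 := mul_le_mul_of_nonneg_left (hy i) hb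
  rw [inner_add_right, inner_smul_right, inner_smul_right]
  have : (c i : ℝ) = a * (c i : ℝ) + b * (c i : ℝ) := by rw [← add_mul, hab, one_mul]
  linarith

theorem NonDegenerate.interior_nonempty {D : ℕ} {ι : Type*} {α : ι → EuclideanSpace ℝ (Fin D)}
    {c : ι → SignType} (h : NonDegenerate α c) : (interior (sat α c)).Nonempty := by
  rw [(convex_sat α c).interior_nonempty_iff_affineSpan_eq_top,
    ← AffineSubspace.direction_eq_top_iff_of_nonempty ((affineSpan_nonempty ℝ).2 h.1)]
  apply Submodule.eq_top_of_finrank_eq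
  rw [finrank_euclideanSpace_fin]
  exact h.2

/-- Farkas' lemma for a finite system that contains the trivial inequality `0 ≥ -1` and whose
nonzero members are strict at some point. -/
theorem exists_nonneg_combination_of_valid {D : ℕ} {κ : Type*} (s : Finset κ)
    (v : κ → EuclideanSpace ℝ (Fin D) × ℝ) (htriv : ∃ k ∈ s, v k = (0, -1))
    (b₀ : EuclideanSpace ℝ (Fin D))
    (hb₀ : ∀ k ∈ s, v k ≠ 0 → (v k).2 < inner ℝ (v k).1 b₀)
    (x : EuclideanSpace ℝ (Fin D) × ℝ) (hxb₀ : x ≠ 0 → x.2 < inner ℝ x.1 b₀)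
    (hx : ∀ b, (∀ k ∈ s, (v k).2 ≤ inner ℝ (v k).1 b) → x.2 ≤ inner ℝ x.1 b) :
    ∃ l : κ → ℝ, (∀ k, 0 ≤ l k) ∧ x = ∑ k ∈ s, l k • v k := by
  classical
  by_cases hx0 : x = 0
  · exact ⟨0, fun _ => le_rfl, by simp [hx0]⟩
  have hxpos := hxb₀ hx0
  set φ : EuclideanSpace ℝ (Fin D) × ℝ → ℝ := fun y => inner ℝ y.1 b₀ - y.2 with hφ
  have hφx : 0 < φ x := sub_pos.2 hxpos
  -- Scaling the nonzero generators to `φ = 1` gives a finite base of the cone; its convex hull is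
  -- compact, so it can be separated strictly from the scaled `x`.
  set G : Set (EuclideanSpace ℝ (Fin D) × ℝ) :=
    (fun k => (φ (v k))⁻¹ • v k) '' {k | k ∈ s ∧ v k ≠ 0} with hG
  have hGfin : G.Finite := (s.finite_toSet.subset fun k hk => hk.1).image _
  by_cases hmem : (φ x)⁻¹ • x ∈ convexHull ℝ G
  · have hsub : convexHull ℝ G ⊆
        {y | ∃ l : κ → ℝ, (∀ k, 0 ≤ l k) ∧ y = ∑ k ∈ s, l k • v k} := by
      refine convexHull_min ?_ ?_
      · rintro _ ⟨k, ⟨hk, hk0⟩, rfl⟩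
        refine ⟨fun i => if i = k then (φ (v k))⁻¹ else 0, fun i => ?_, by simp [hk]⟩
        dsimp only
        split_ifs
        · exact inv_nonneg.2 (sub_nonneg.2 (hb₀ k hk hk0).le)
        · exact le_rfl
      · rintro _ ⟨l, hl, rfl⟩ _ ⟨m, hm, rfl⟩ a b ha hb _
        refine ⟨fun k => a * l k + b * m k,
          fun k => add_nonneg (mul_nonneg ha (hl k)) (mul_nonneg hb (hm k)), ?_⟩
        simp only [add_smul, mul_smul, Finset.sum_add_distrib, Finset.smul_sum]
    obtain ⟨l, hl, hlx⟩ := hsub hmem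
    refine ⟨fun k => φ x * l k, fun k => mul_nonneg hφx.le (hl k), ?_⟩
    simp only [mul_smul]
    rw [← Finset.smul_sum, ← hlx, smul_inv_smul₀ hφx.ne']
  · exfalso
    obtain ⟨f, u, hfx, hfG⟩ := geometric_hahn_banach_point_closed (convex_convexHull ℝ G)
      (hGfin.isCompact_convexHull ℝ).isClosed hmem
    set y := (InnerProductSpace.toDual ℝ (EuclideanSpace ℝ (Fin D))).symm
      (f.comp (ContinuousLinearMap.inl ℝ _ ℝ)) with hy
    -- Subtracting `u * φ` turns the separating level `u` into `0`, and `-τ` is then the weight of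
    -- the constant term. The trivial inequality forces `τ > 0`, so dividing by `τ` produces an
    -- actual point of `ℝ^D`.
    set τ : ℝ := -f (0, 1) - u with hτ
    have hrep : ∀ w : EuclideanSpace ℝ (Fin D) × ℝ,
        f w - u * φ w = inner ℝ w.1 (y - u • b₀) - τ * w.2 := by
      intro w
      have h1 : f w = inner ℝ w.1 y + w.2 * f (0, 1) := by
        rw [real_inner_comm, hy, InnerProductSpace.toDual_symm_apply]
        have : w = (w.1, 0) + w.2 • (0, 1) := by ext <;> simp
        conv_lhs => rw [this, map_add, map_smul]
        simp
      rw [h1, hφ, inner_sub_right, inner_smul_right]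
      simp only [hτ]
      ring
    have hneg : f x - u * φ x < 0 := by
      rw [map_smul, smul_eq_mul, inv_mul_lt_iff₀ hφx] at hfx
      linarith
    have hpos : ∀ k ∈ s, v k ≠ 0 → 0 < f (v k) - u * φ (v k) := by
      intro k hk hk0
      have h := hfG _ (subset_convexHull ℝ G ⟨k, ⟨hk, hk0⟩, rfl⟩)
      have hp : 0 < φ (v k) := sub_pos.2 (hb₀ k hk hk0)
      rw [map_smul, smul_eq_mul, lt_inv_mul_iff₀ hp] at h
      linarith
    have hτpos : 0 < τ := by
      obtain ⟨k, hk, hkv⟩ := htriv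
      have h := hpos k hk (by rw [hkv]; simp [Prod.ext_iff])
      rw [hrep, hkv] at h
      simpa using h
    rw [hrep] at hneg
    -- This point satisfies the whole system but violates `x`.
    have hle := hx (τ⁻¹ • (y - u • b₀)) (fun k hk => by
      rw [inner_smul_right, le_inv_mul_iff₀ hτpos]
      by_cases hk0 : v k = 0
      · simp [hk0]
      · have h := hpos k hk hk0
        rw [hrep] at h
        linarith)
    rw [inner_smul_right, le_inv_mul_iff₀ hτpos] at hle
    linarith

/-! ### Essential inequalities and minimal representations -/

/-- The coefficient vector of a constraint, as a point of `ℝ^D × ℝ`. -/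
def LinConstr.toProd {D : ℕ} (x : LinConstr D) : EuclideanSpace ℝ (Fin D) × ℝ :=
  (x.vec, (x.off : ℝ))

theorem LinConstr.normEquiv_iff {D : ℕ} {x y : LinConstr D} :
    x.NormEquiv y ↔ ∃ t : ℝ, 0 < t ∧ y.toProd = t • x.toProd := by
  simp [LinConstr.NormEquiv, LinConstr.toProd, Prod.ext_iff]

theorem LinConstr.NormEquiv.symm {D : ℕ} {x y : LinConstr D} (h : x.NormEquiv y) :
    y.NormEquiv x := by
  rw [LinConstr.normEquiv_iff] at *
  obtain ⟨t, ht, h⟩ := h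
  exact ⟨t⁻¹, inv_pos.2 ht, by rw [h, inv_smul_smul₀ ht.ne']⟩

theorem LinConstr.NormEquiv.trans {D : ℕ} {x y z : LinConstr D} (h : x.NormEquiv y)
    (h' : y.NormEquiv z) : x.NormEquiv z := by
  rw [LinConstr.normEquiv_iff] at *
  obtain ⟨t, ht, h⟩ := h
  obtain ⟨r, hr, h'⟩ := h'
  exact ⟨r * t, mul_pos hr ht, by rw [h', h, mul_smul]⟩

/-- `x` spans an extreme ray of the cone of valid inequalities of `X`, other than the ray of the
trivial inequality. -/
structure IsEssential {D : ℕ} (X : Set (EuclideanSpace ℝ (Fin D)))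
    (x : EuclideanSpace ℝ (Fin D) × ℝ) : Prop where
  mem : x ∈ validCone X
  extreme : ∀ y ∈ validCone X, ∀ z ∈ validCone X, y + z = x → ∃ t : ℝ, 0 ≤ t ∧ y = t • x
  ne_trivial : ∀ t : ℝ, x ≠ t • (0, -1)

section Representation

variable {D : ℕ} {X : Set (EuclideanSpace ℝ (Fin D))}

theorem IsEssential.ne_zero {x : EuclideanSpace ℝ (Fin D) × ℝ} (h : IsEssential X x) : x ≠ 0 :=
  fun h0 => h.ne_trivial 0 (by rw [h0, zero_smul])

theorem IsEssential.smul {x : EuclideanSpace ℝ (Fin D) × ℝ} (h : IsEssential X x) {r : ℝ}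
    (hr : 0 < r) : IsEssential X (r • x) where
  mem := smul_mem_validCone h.mem hr.le
  extreme := fun y hy z hz hyz => by
    obtain ⟨t, ht, hty⟩ := h.extreme (r⁻¹ • y) (smul_mem_validCone hy (inv_pos.2 hr).le)
      (r⁻¹ • z) (smul_mem_validCone hz (inv_pos.2 hr).le)
      (by rw [← smul_add, hyz, inv_smul_smul₀ hr.ne'])
    refine ⟨t, ht, ?_⟩
    rw [inv_smul_eq_iff₀ hr.ne'] at hty
    rw [hty, smul_comm]
  ne_trivial := fun t ht => h.ne_trivial (r⁻¹ * t) (by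
    rw [mul_smul, ← ht, inv_smul_smul₀ hr.ne'])

/-- In any combination of valid inequalities giving an essential one, all terms are multiples of
it. -/
theorem IsEssential.eq_smul_of_sum {x : EuclideanSpace ℝ (Fin D) × ℝ} (h : IsEssential X x)
    {κ : Type*} (s : Finset κ) (v : κ → EuclideanSpace ℝ (Fin D) × ℝ)
    (hv : ∀ k ∈ s, v k ∈ validCone X) (l : κ → ℝ) (hl : ∀ k, 0 ≤ l k)
    (hx : x = ∑ k ∈ s, l k • v k) (k : κ) (hk : k ∈ s) (hlk : 0 < l k) (hvk : v k ≠ 0) :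
    ∃ t : ℝ, 0 < t ∧ v k = t • x := by
  classical
  obtain ⟨t, ht, htk⟩ := h.extreme (l k • v k) (smul_mem_validCone (hv k hk) (hl k))
    (∑ i ∈ s.erase k, l i • v i)
    (sum_mem_validCone _ _ fun i hi =>
      smul_mem_validCone (hv i (Finset.mem_of_mem_erase hi)) (hl i))
    (by rw [Finset.add_sum_erase s (fun i => l i • v i) hk, hx])
  have hvk' : v k = ((l k)⁻¹ * t) • x := by
    rw [mul_smul, ← htk, inv_smul_smul₀ hlk.ne']
  refine ⟨(l k)⁻¹ * t, lt_of_le_of_ne (mul_nonneg (inv_nonneg.2 hlk.le) ht) fun h0 => ?_, hvk'⟩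
  rw [← h0, zero_smul] at hvk'
  exact hvk hvk'

theorem toProd_mem_validCone {T : Finset (LinConstr D)} (hT : satSet T = X) {t : LinConstr D}
    (ht : t ∈ T) : t.toProd ∈ validCone X := by
  subst hT
  exact fun b hb => hb t ht

theorem trivial_mem_validCone : ((0, -1) : EuclideanSpace ℝ (Fin D) × ℝ) ∈ validCone X :=
  fun b _ => by simp

/-- Every representation contains every essential inequality. -/
theorem IsEssential.exists_mem {x : EuclideanSpace ℝ (Fin D) × ℝ} (h : IsEssential X x)
    {T : Finset (LinConstr D)} (hT : satSet T = X) (hX : (interior X).Nonempty) :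
    ∃ t ∈ T, ∃ r : ℝ, 0 < r ∧ t.toProd = r • x := by
  classical
  obtain ⟨b₀, hb₀⟩ := hX
  -- `T` need not contain the trivial inequality that Farkas' lemma requires; adjoining it does no
  -- harm, since an essential inequality is never a multiple of it.
  have hvalid : ∀ k ∈ insert (⟨0, -1⟩ : LinConstr D) T, k.toProd ∈ validCone X := by
    intro k hk
    rcases Finset.mem_insert.1 hk with rfl | hk
    · simpa [LinConstr.toProd] using trivial_mem_validCone (X := X)
    · exact toProd_mem_validCone hT hk
  obtain ⟨l, hl, hlx⟩ := exists_nonneg_combination_of_valid (insert ⟨0, -1⟩ T)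
    LinConstr.toProd ⟨_, Finset.mem_insert_self _ _, by simp [LinConstr.toProd]⟩ b₀
    (fun k hk hk0 => lt_inner_of_mem_interior hb₀ (hvalid k hk) hk0) x
    (fun hx0 => lt_inner_of_mem_interior hb₀ h.mem hx0)
    (fun b hb => h.mem b (by
      rw [← hT]
      exact fun k hk => hb k (Finset.mem_insert_of_mem hk)))
  obtain ⟨k, hk, hk0⟩ := Finset.exists_ne_zero_of_sum_ne_zero (hlx ▸ h.ne_zero)
  obtain ⟨hlk, hvk⟩ := smul_ne_zero_iff.1 hk0
  obtain ⟨t, ht, hkt⟩ := h.eq_smul_of_sum _ _ hvalid l hl hlx k hk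
    (lt_of_le_of_ne (hl k) hlk.symm) hvk
  refine ⟨k, (Finset.mem_insert.1 hk).resolve_left fun hk1 => ?_, t, ht, hkt⟩
  refine h.ne_trivial t⁻¹ ?_
  rw [← inv_smul_smul₀ ht.ne' x, ← hkt, hk1]
  simp [LinConstr.toProd]

end Representation

section System

variable {D : ℕ} {ι : Type*} {α : ι → EuclideanSpace ℝ (Fin D)} {c : ι → SignType}

theorem coeff_mem_validCone (i : ι) : (α i, (c i : ℝ)) ∈ validCone (sat α c) :=
  fun _ hb => hb i

theorem coeff_ne_zero (hne : ∀ i, c i = 0 → α i ≠ 0) (i : ι) :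
    ((α i, (c i : ℝ)) : EuclideanSpace ℝ (Fin D) × ℝ) ≠ 0 := by
  intro h
  rw [Prod.ext_iff] at h
  refine hne i ?_ h.1
  have h2 : (c i : ℝ) = 0 := h.2
  revert h2
  cases c i <;> simp

variable [Fintype ι]

theorem exists_combination_of_mem_validCone (hzero : ∃ i, c i = -1 ∧ α i = 0)
    (hX : (interior (sat α c)).Nonempty) {x : EuclideanSpace ℝ (Fin D) × ℝ}
    (hx : x ∈ validCone (sat α c)) :
    ∃ l : ι → ℝ, (∀ i, 0 ≤ l i) ∧ x = ∑ i, l i • (α i, (c i : ℝ)) := by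
  obtain ⟨b₀, hb₀⟩ := hX
  obtain ⟨i, hi, hi'⟩ := hzero
  exact exists_nonneg_combination_of_valid Finset.univ (fun i => (α i, (c i : ℝ)))
    ⟨i, Finset.mem_univ _, by simp [hi, hi']⟩ b₀
    (fun k _ hk => lt_inner_of_mem_interior hb₀ (coeff_mem_validCone k) hk) x
    (fun hx0 => lt_inner_of_mem_interior hb₀ hx hx0)
    (fun b hb => hx b fun i => hb i (Finset.mem_univ i))

/-- Pointedness of the cone: evaluated at an interior point, every generator has positive slack, so
a vanishing nonnegative combination has zero weights. -/
theorem eq_zero_of_combination_eq_zero (hne : ∀ i, c i = 0 → α i ≠ 0)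
    (hX : (interior (sat α c)).Nonempty) {l : ι → ℝ} (hl : ∀ i, 0 ≤ l i)
    (h : ∑ i, l i • ((α i, (c i : ℝ)) : EuclideanSpace ℝ (Fin D) × ℝ) = 0) (i : ι) :
    l i = 0 := by
  obtain ⟨b₀, hb₀⟩ := hX
  have hpos : ∀ i, 0 < inner ℝ (α i) b₀ - (c i : ℝ) := fun i =>
    sub_pos.2 (lt_inner_of_mem_interior hb₀ (coeff_mem_validCone i) (coeff_ne_zero hne i))
  have h1 : ∑ i, l i * (inner ℝ (α i) b₀ - (c i : ℝ)) = 0 := by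
    have ha := congrArg (fun w => inner ℝ w.1 b₀ - w.2) h
    simpa [Prod.fst_sum, Prod.snd_sum, sum_inner, inner_smul_left, mul_sub] using ha
  have h2 := (Finset.sum_eq_zero_iff_of_nonneg
    fun i _ => mul_nonneg (hl i) (hpos i).le).1 h1 i (Finset.mem_univ i)
  exact (mul_eq_zero.1 h2).resolve_right (hpos i).ne'

/-- A criterion for essential inequalities in terms of the given system only. -/
theorem isEssential_of_combinations (hzero : ∃ i, c i = -1 ∧ α i = 0)
    (hX : (interior (sat α c)).Nonempty) {i : ι} (hi : ¬ (c i = -1 ∧ α i = 0))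
    (hne : ∀ i, c i = 0 → α i ≠ 0)
    (h : ∀ l : ι → ℝ, (∀ k, 0 ≤ l k) →
      ((α i, (c i : ℝ)) : EuclideanSpace ℝ (Fin D) × ℝ) = ∑ k, l k • (α k, (c k : ℝ)) →
      ∀ k, 0 < l k → ∃ t : ℝ, 0 < t ∧ (α k, (c k : ℝ)) = t • (α i, (c i : ℝ))) :
    IsEssential (sat α c) (α i, (c i : ℝ)) where
  mem := coeff_mem_validCone i
  extreme := by
    intro y hy z hz hyz
    obtain ⟨l, hl, rfl⟩ := exists_combination_of_mem_validCone hzero hX hy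
    obtain ⟨m, hm, rfl⟩ := exists_combination_of_mem_validCone hzero hX hz
    have hk : ∀ k, ∃ t : ℝ, 0 ≤ t ∧ l k • ((α k, (c k : ℝ)) : EuclideanSpace ℝ (Fin D) × ℝ)
        = t • (α i, (c i : ℝ)) := by
      intro k
      rcases (hl k).eq_or_lt with h0 | h0
      · exact ⟨0, le_rfl, by rw [← h0, zero_smul, zero_smul]⟩
      -- The combinations for `y` and `z` add up to one for the given inequality, and `m k ≥ 0`
      -- keeps the `k`-th weight positive.
      · obtain ⟨t, ht, hkt⟩ := h (fun k => l k + m k) (fun k => add_nonneg (hl k) (hm k))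
          (by simp only [add_smul, Finset.sum_add_distrib]; exact hyz.symm) k
          (add_pos_of_pos_of_nonneg h0 (hm k))
        exact ⟨l k * t, mul_nonneg h0.le ht.le, by rw [hkt, mul_smul]⟩
    choose t ht hkt using hk
    refine ⟨∑ k, t k, Finset.sum_nonneg fun k _ => ht k, ?_⟩
    rw [Finset.sum_smul]
    exact Finset.sum_congr rfl fun k _ => hkt k
  ne_trivial := by
    intro t ht
    rw [Prod.ext_iff] at ht
    simp only [Prod.smul_mk, smul_zero, smul_eq_mul, mul_neg, mul_one] at ht
    obtain ⟨h1, h2⟩ := ht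
    have hc : c i = 0 ∨ c i = 1 ∨ c i = -1 := by
      generalize c i = a; revert a; decide
    rcases hc with hc | hc | hc
    · exact hne i hc h1
    · obtain ⟨b, hb⟩ := hX
      have := interior_subset hb i
      rw [h1, hc] at this
      simp only [SignType.coe_one, inner_zero_left] at this
      linarith
    · exact hi ⟨hc, h1⟩

/-- A representation by pairwise inequivalent essential inequalities of the system. -/
theorem exists_essential_representation (hzero : ∃ i, c i = -1 ∧ α i = 0)
    (hne : ∀ i, c i = 0 → α i ≠ 0) (hX : (interior (sat α c)).Nonempty) :
    ∃ S : Finset (LinConstr D), satSet S = sat α c ∧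
      (∀ x ∈ S, IsEssential (sat α c) x.toProd ∧ ∃ i, x = ⟨α i, c i⟩) ∧
      ∀ x ∈ S, ∀ y ∈ S, x.NormEquiv y → x = y := by
  classical
  obtain ⟨B, -, hgen, hext, hinj⟩ := exists_extreme_generators
    (fun i => ((α i, (c i : ℝ)) : EuclideanSpace ℝ (Fin D) × ℝ)) Finset.univ
    (fun l hl h i _ => eq_zero_of_combination_eq_zero hne hX hl h i)
  refine ⟨(B.filter fun i => ¬ (c i = -1 ∧ α i = 0)).image fun i => ⟨α i, c i⟩, ?_, ?_, ?_⟩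
  · ext b
    constructor
    · intro hb i
      obtain ⟨l, hl, hli⟩ := hgen i (Finset.mem_univ i)
      have h1 : ∀ k ∈ B, (c k : ℝ) ≤ inner ℝ (α k) b := by
        intro k hk
        by_cases h0 : c k = -1 ∧ α k = 0
        · simp [h0.1, h0.2]
        · exact hb ⟨α k, c k⟩ (Finset.mem_image.2 ⟨k, Finset.mem_filter.2 ⟨hk, h0⟩, rfl⟩)
      rw [Prod.ext_iff] at hli
      simp only [Prod.fst_sum, Prod.snd_sum, Prod.smul_mk, smul_eq_mul] at hli
      rw [hli.1, hli.2, sum_inner]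
      refine Finset.sum_le_sum fun k hk => ?_
      rw [inner_smul_left]
      exact mul_le_mul_of_nonneg_left (h1 k hk) (hl k)
    · intro hb x hx
      obtain ⟨i, -, rfl⟩ := Finset.mem_image.1 hx
      exact hb i
  · intro x hx
    obtain ⟨i, hi, rfl⟩ := Finset.mem_image.1 hx
    rw [Finset.mem_filter] at hi
    exact ⟨isEssential_of_combinations hzero hX hi.2 hne fun l hl h k hk =>
      hext i hi.1 l hl h k (Finset.mem_univ k) hk, i, rfl⟩
  · intro x hx y hy hxy
    obtain ⟨i, hi, rfl⟩ := Finset.mem_image.1 hx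
    obtain ⟨j, hj, rfl⟩ := Finset.mem_image.1 hy
    rw [Finset.mem_filter] at hi hj
    obtain ⟨t, ht, h⟩ := LinConstr.normEquiv_iff.1 hxy
    rw [hinj i hi.1 j hj.1 t ht h]

theorem exists_injOn_of_essential {X : Set (EuclideanSpace ℝ (Fin D))}
    (hX : (interior X).Nonempty) {S T : Finset (LinConstr D)}
    (hS : ∀ x ∈ S, IsEssential X x.toProd) (hSinj : ∀ x ∈ S, ∀ y ∈ S, x.NormEquiv y → x = y)
    (hT : satSet T = X) :
    ∃ f : LinConstr D → LinConstr D, (∀ x ∈ S, f x ∈ T ∧ x.NormEquiv (f x)) ∧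
      Set.InjOn f S := by
  have h : ∀ x ∈ S, ∃ t ∈ T, x.NormEquiv t := fun x hx => by
    obtain ⟨t, ht, r, hr, h⟩ := (hS x hx).exists_mem hT hX
    exact ⟨t, ht, LinConstr.normEquiv_iff.2 ⟨r, hr, h⟩⟩
  choose! f hfT hfe using h
  exact ⟨f, fun x hx => ⟨hfT x hx, hfe x hx⟩, fun x hx y hy hxy =>
    hSinj x hx y hy ((hfe x hx).trans (hxy ▸ (hfe y hy).symm))⟩

theorem exists_isMinRep (hzero : ∃ i, c i = -1 ∧ α i = 0)
    (hne : ∀ i, c i = 0 → α i ≠ 0) (hX : (interior (sat α c)).Nonempty) :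
    ∃ S, IsMinRep α c S := by
  obtain ⟨S, hS, hess, hinj⟩ := exists_essential_representation hzero hne hX
  refine ⟨S, hS, fun T hT => ?_⟩
  obtain ⟨f, hf, hfi⟩ := exists_injOn_of_essential hX (fun x hx => (hess x hx).1) hinj hT
  exact Finset.card_le_card_of_injOn f (fun x hx => (hf x hx).1) hfi

/-- The essential representation injects into `S` by normalisation; since `S` has least cardinality,
the injection is onto, so every member of `S` is a multiple of an essential one. -/
theorem IsMinRep.isEssential_of_mem (hzero : ∃ i, c i = -1 ∧ α i = 0)
    (hne : ∀ i, c i = 0 → α i ≠ 0) (hX : (interior (sat α c)).Nonempty)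
    {S : Finset (LinConstr D)} (hS : IsMinRep α c S) {x : LinConstr D} (hx : x ∈ S) :
    IsEssential (sat α c) x.toProd ∧ ∃ i, x.NormEquiv ⟨α i, c i⟩ := by
  obtain ⟨R, hR, hess, hinj⟩ := exists_essential_representation hzero hne hX
  obtain ⟨f, hf, hfi⟩ := exists_injOn_of_essential hX (fun x hx => (hess x hx).1) hinj hS.1
  obtain ⟨y, hy, rfl⟩ := Finset.surj_on_of_inj_on_of_card_le (fun y _ => f y)
    (fun y hy => (hf y hy).1) (fun y z hy hz h => hfi hy hz h) (hS.2 R hR) x hx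
  obtain ⟨t, ht, h⟩ := LinConstr.normEquiv_iff.1 (hf y hy).2
  obtain ⟨hye, i, rfl⟩ := hess y hy
  exact ⟨h ▸ hye.smul ht, i, (hf _ hy).2.symm⟩

/-- Membership in a minimal representation, up to normalisation. -/
theorem IsMinRep.memNorm_iff (hzero : ∃ i, c i = -1 ∧ α i = 0)
    (hne : ∀ i, c i = 0 → α i ≠ 0) (hX : (interior (sat α c)).Nonempty)
    {S : Finset (LinConstr D)} (hS : IsMinRep α c S) (x : LinConstr D) :
    MemNorm x S ↔ IsEssential (sat α c) x.toProd := by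
  constructor
  · rintro ⟨y, hy, hxy⟩
    obtain ⟨t, ht, h⟩ := LinConstr.normEquiv_iff.1 hxy.symm
    exact h ▸ (hS.isEssential_of_mem hzero hne hX hy).1.smul ht
  · intro hx
    obtain ⟨t, ht, r, hr, h⟩ := hx.exists_mem hS.1 hX
    exact ⟨t, ht, LinConstr.normEquiv_iff.2 ⟨r, hr, h⟩⟩

end System

/-! ### Extreme sets of `reg` and `hullH` near a point `α i` -/

theorem SignType.mul_self_cast {s : SignType} (hs : s ≠ 0) : (s : ℝ) * s = 1 := by
  revert hs; cases s <;> simp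

theorem SignType.eq_or_eq_zero_or_eq_neg {s : SignType} (hs : s ≠ 0) (a : SignType) :
    a = s ∨ a = 0 ∨ a = -s := by
  revert s a; decide

/-- A member of an extreme set that is a convex combination of points has all the points with
positive weight in the extreme set. -/
theorem IsExtreme.mem_of_sum_mem {W ι : Type*} [AddCommGroup W] [Module ℝ W] [Fintype ι]
    {C F : Set W} (hC : Convex ℝ C) (hF : IsExtreme ℝ C F) {x₀ : W} (hx₀ : x₀ ∈ C) {x : ι → W}
    (hx : ∀ i, x i ∈ C) {w : ι → ℝ} (hw : ∀ i, 0 ≤ w i) (hw1 : ∑ i, w i < 1)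
    (h : x₀ + ∑ i, w i • (x i - x₀) ∈ F) (k : ι) (hk : 0 < w k) : x k ∈ F := by
  classical
  have hsum : ∑ i, w i = w k + ∑ i ∈ Finset.univ.erase k, w i :=
    (Finset.add_sum_erase _ w (Finset.mem_univ k)).symm
  have hrest : 0 ≤ ∑ i ∈ Finset.univ.erase k, w i := Finset.sum_nonneg fun i _ => hw i
  have hk1 : 0 < 1 - w k := by linarith
  -- The given point is `w k • x k + (1 - w k) • y`; `y` gathers all other terms, with the leftover
  -- weight placed on `x₀`.
  set y : W := x₀ + ∑ i ∈ Finset.univ.erase k, ((1 - w k)⁻¹ * w i) • (x i - x₀) with hy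
  have hyC : y ∈ C := by
    set q : ℝ := ∑ i ∈ Finset.univ.erase k, (1 - w k)⁻¹ * w i with hq
    have hq1 : q ≤ 1 := by
      rw [hq, ← Finset.mul_sum, inv_mul_le_iff₀ hk1]
      linarith
    have hmem := hC.sum_mem (t := Finset.univ)
      (w := fun o : Option ι => o.elim (1 - q) fun i => if i = k then 0 else (1 - w k)⁻¹ * w i)
      (z := fun o : Option ι => o.elim x₀ x)
      (by
        rintro (_ | i) -
        · simpa using hq1
        · simp only [Option.elim_some]
          split_ifs
          · exact le_rfl
          · exact mul_nonneg (inv_nonneg.2 hk1.le) (hw i))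
      (by
        rw [Fintype.sum_option]
        simp only [Option.elim_none, Option.elim_some]
        rw [← Finset.add_sum_erase _ _ (Finset.mem_univ k), if_pos rfl,
          Finset.sum_congr rfl fun i hi => if_neg (Finset.ne_of_mem_erase hi)]
        linarith)
      (by
        rintro (_ | i) -
        · exact hx₀
        · exact hx i)
    convert hmem using 1
    rw [Fintype.sum_option]
    simp only [Option.elim_none, Option.elim_some]
    rw [← Finset.add_sum_erase Finset.univ
        (fun i => (if i = k then 0 else (1 - w k)⁻¹ * w i) • x i) (Finset.mem_univ k),
      if_pos rfl, zero_smul, zero_add,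
      Finset.sum_congr rfl fun i hi => by rw [if_neg (Finset.ne_of_mem_erase hi)], hy]
    simp only [smul_sub, Finset.sum_sub_distrib, ← Finset.sum_smul]
    rw [← hq]
    module
  refine hF.left_mem_of_mem_openSegment (hx k) hyC h ⟨w k, 1 - w k, hk, hk1, by ring, ?_⟩
  rw [hy, smul_add, Finset.smul_sum,
    ← Finset.add_sum_erase _ (fun i => w i • (x i - x₀)) (Finset.mem_univ k)]
  have : ∀ i, (1 - w k) • ((1 - w k)⁻¹ * w i) • (x i - x₀) = w i • (x i - x₀) := fun i => by
    rw [mul_smul, smul_inv_smul₀ hk1.ne']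
  simp only [this]
  module

section Faces

variable {D : ℕ} {ι : Type*} {α : ι → EuclideanSpace ℝ (Fin D)} {c : ι → SignType}

/-- The generating point of `hullH` that lies in the direction of `reg` given by the `k`-th
constraint, as seen from `α i`. -/
noncomputable def neighbour (α : ι → EuclideanSpace ℝ (Fin D)) (c : ι → SignType) (s : SignType)
    (p : ℕ) (i k : ι) : EuclideanSpace ℝ (Fin D) :=
  if c k = s then α k
  else if c k = 0 then α i + ((p : ℝ) - 1) • α k
  else (p : ℝ) • α i + ((p : ℝ) - 1) • α k

theorem mem_hullH {s : SignType} {p : ℕ} {i : ι} (hi : c i = s) : α i ∈ hullH α c s p :=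
  subset_convexHull ℝ _ (Or.inl (Or.inl ⟨i, hi, rfl⟩))

theorem neighbour_mem_hullH {s : SignType} (hs : s ≠ 0) (p : ℕ) {i : ι} (hi : c i = s) (k : ι) :
    neighbour α c s p i k ∈ hullH α c s p := by
  apply subset_convexHull
  unfold neighbour
  split_ifs with h1 h2
  · exact Or.inl (Or.inl ⟨k, h1, rfl⟩)
  · exact Or.inl (Or.inr ⟨i, k, hi, h2, rfl⟩)
  · exact Or.inr ⟨i, k, hi,
      ((SignType.eq_or_eq_zero_or_eq_neg hs (c k)).resolve_left h1).resolve_left h2, rfl⟩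

/-- The factor is positive for `p > 1`, so a neighbour lies in the same direction from `α i` as the
height-preserving move of the `k`-th generator. -/
theorem neighbour_sub {s : SignType} (hs : s ≠ 0) (p : ℕ) (i k : ι) :
    neighbour α c s p i k - α i
      = (if c k = s then 1 else (p : ℝ) - 1) • (α k - ((s : ℝ) * c k) • α i) := by
  unfold neighbour
  split_ifs with h1 h2
  · rw [h1, SignType.mul_self_cast hs]
    module
  · rw [h2]
    simp
  · have h3 := ((SignType.eq_or_eq_zero_or_eq_neg hs (c k)).resolve_left h1).resolve_left h2
    rw [h3, SignType.coe_neg, mul_neg, SignType.mul_self_cast hs]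
    module

variable [Fintype ι]

/-- If an extreme set of `C` contains points of `C` close to `α i` in the direction of a
combination of constraints, it contains the neighbours of `α i` for these constraints. -/
theorem neighbour_mem_of_isExtreme {s : SignType} (hs : s ≠ 0) {p : ℕ} (hp : 1 < p)
    {C F : Set (EuclideanSpace ℝ (Fin D))} (hC : Convex ℝ C) (hHC : hullH α c s p ⊆ C)
    (hF : IsExtreme ℝ C F) {i : ι} (hi : c i = s) {l : ι → ℝ} (hl : ∀ k, 0 ≤ l k) {e₀ : ℝ}
    (he₀ : 0 < e₀)
    (h : ∀ e, 0 < e → e ≤ e₀ → α i + e • ∑ k, l k • (α k - ((s : ℝ) * c k) • α i) ∈ F)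
    (k : ι) (hk : 0 < l k) : neighbour α c s p i k ∈ F := by
  have hp' : (0 : ℝ) < (p : ℝ) - 1 := by
    have : (1 : ℝ) < p := by exact_mod_cast hp
    linarith
  set w : ι → ℝ := fun k => if c k = s then 1 else (p : ℝ) - 1 with hw
  have hwpos : ∀ k, 0 < w k := fun k => by
    simp only [hw]
    split_ifs
    · exact one_pos
    · exact hp'
  set M : ℝ := ∑ k, l k / w k with hM
  have hM0 : 0 ≤ M := Finset.sum_nonneg fun k _ => div_nonneg (hl k) (hwpos k).le
  -- This step is short enough that the weights on the neighbours total `e * M < 1`.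
  set e : ℝ := min e₀ (1 / (M + 1)) with he
  have hepos : 0 < e := lt_min he₀ (by positivity)
  refine hF.mem_of_sum_mem hC (hHC (mem_hullH hi))
    (fun k => hHC (neighbour_mem_hullH hs p hi k)) (w := fun k => e * (l k / w k))
    (fun k => mul_nonneg hepos.le (div_nonneg (hl k) (hwpos k).le)) ?_ ?_ k
    (mul_pos hepos (div_pos hk (hwpos k)))
  · rw [← Finset.mul_sum, ← hM]
    calc e * M ≤ 1 / (M + 1) * M := mul_le_mul_of_nonneg_right (min_le_right _ _) hM0
      _ < 1 := by rw [one_div, inv_mul_lt_iff₀ (by positivity)]; linarith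
  · convert h e hepos (min_le_left _ _) using 2
    rw [Finset.smul_sum]
    refine Finset.sum_congr rfl fun k _ => ?_
    have hwk : (if c k = s then 1 else (p : ℝ) - 1) = w k := rfl
    rw [neighbour_sub hs, hwk, smul_smul, smul_smul, mul_assoc, div_mul_cancel₀ _ (hwpos k).ne']

/-- The inequality in `reg` becomes an equality of heights by adding a multiple of the trivial pair,
so `reg` is a slice of the valid cone. -/
theorem mem_reg_iff (hzero : ∃ i, c i = -1 ∧ α i = 0) (hX : (interior (sat α c)).Nonempty)
    {s : SignType} {β : EuclideanSpace ℝ (Fin D)} :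
    β ∈ reg α c s ↔ (β, (s : ℝ)) ∈ validCone (sat α c) := by
  constructor
  · rintro ⟨l, hl, hs, rfl⟩ b hb
    refine hs.trans ?_
    simp only [sum_inner, inner_smul_left]
    exact Finset.sum_le_sum fun i _ => mul_le_mul_of_nonneg_left (hb i) (hl i)
  · intro h
    obtain ⟨l, hl, h⟩ := exists_combination_of_mem_validCone hzero hX h
    rw [Prod.ext_iff] at h
    simp only [Prod.fst_sum, Prod.snd_sum, Prod.smul_mk, smul_eq_mul] at h
    exact ⟨l, hl, h.2.le, h.1⟩

theorem convex_reg (s : SignType) : Convex ℝ (reg α c s) := by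
  rintro _ ⟨l, hl, hls, rfl⟩ _ ⟨m, hm, hms, rfl⟩ a b ha hb hab
  refine ⟨fun i => a * l i + b * m i,
    fun i => add_nonneg (mul_nonneg ha (hl i)) (mul_nonneg hb (hm i)), ?_, ?_⟩
  · have h1 := mul_le_mul_of_nonneg_left hls ha
    have h2 := mul_le_mul_of_nonneg_left hms hb
    have h3 : (s : ℝ) = a * s + b * s := by rw [← add_mul, hab, one_mul]
    simp only [add_mul, Finset.sum_add_distrib, mul_assoc, ← Finset.mul_sum]
    linarith
  · simp only [add_smul, mul_smul, Finset.sum_add_distrib, Finset.smul_sum]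

theorem hullH_subset_reg (hzero : ∃ i, c i = -1 ∧ α i = 0)
    (hX : (interior (sat α c)).Nonempty) {s : SignType} {p : ℕ} (hp : 1 < p) :
    hullH α c s p ⊆ reg α c s := by
  have hp' : (0 : ℝ) ≤ (p : ℝ) - 1 := by
    have : (1 : ℝ) < p := by exact_mod_cast hp
    linarith
  refine convexHull_min ?_ (convex_reg s)
  rintro β ((⟨i, hi, rfl⟩ | ⟨i, j, hi, hj, rfl⟩) | ⟨i, j, hi, hj, rfl⟩) <;>
    rw [mem_reg_iff hzero hX]
  · exact hi ▸ coeff_mem_validCone i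
  · convert add_mem_validCone (coeff_mem_validCone (α := α) (c := c) i)
      (smul_mem_validCone (coeff_mem_validCone j) hp') using 1
    simp [hi, hj]
  · convert add_mem_validCone
      (smul_mem_validCone (coeff_mem_validCone (α := α) (c := c) i) (Nat.cast_nonneg p))
      (smul_mem_validCone (coeff_mem_validCone j) hp') using 1
    simp only [hi, hj, SignType.coe_neg, Prod.smul_mk, Prod.mk_add_mk, smul_eq_mul]
    congr 1
    ring

/-- An essential inhomogeneous inequality gives an extreme point. -/
theorem IsEssential.mem_extremePoints_reg (hzero : ∃ i, c i = -1 ∧ α i = 0)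
    (hX : (interior (sat α c)).Nonempty) {s : SignType} (hs : s ≠ 0) {i : ι} (hi : c i = s)
    (h : IsEssential (sat α c) (α i, (c i : ℝ))) : α i ∈ (reg α c s).extremePoints ℝ := by
  have hs' : (s : ℝ) ≠ 0 := fun h0 => by
    have := SignType.mul_self_cast hs
    rw [h0] at this
    simp at this
  rw [hi] at h
  refine mem_extremePoints_iff_left.2 ⟨(mem_reg_iff hzero hX).2 h.mem, ?_⟩
  rintro y hy z hz ⟨a, b, ha, hb, hab, hyz⟩
  rw [mem_reg_iff hzero hX] at hy hz
  obtain ⟨t, ht, hty⟩ := h.extreme (a • (y, (s : ℝ))) (smul_mem_validCone hy ha.le)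
    (b • (z, (s : ℝ))) (smul_mem_validCone hz hb.le) (by
      simp only [Prod.smul_mk, Prod.mk_add_mk, hyz, smul_eq_mul]
      rw [← add_mul, hab, one_mul])
  simp only [Prod.smul_mk, Prod.mk.injEq, smul_eq_mul] at hty
  have hat : a = t := mul_right_cancel₀ hs' hty.2
  exact smul_right_injective _ ha.ne' (hat ▸ hty.1)

/-- A nontrivial inhomogeneous inequality whose vector is extreme is essential. -/
theorem isEssential_of_mem_extremePoints (hzero : ∃ i, c i = -1 ∧ α i = 0)
    (hne : ∀ i, c i = 0 → α i ≠ 0) (hX : (interior (sat α c)).Nonempty) {s : SignType}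
    (hs : s ≠ 0) {p : ℕ} (hp : 1 < p) {C : Set (EuclideanSpace ℝ (Fin D))} (hC : Convex ℝ C)
    (hHC : hullH α c s p ⊆ C) {i : ι} (hi : c i = s) (htriv : ¬ (c i = -1 ∧ α i = 0))
    (h : α i ∈ C.extremePoints ℝ) : IsEssential (sat α c) (α i, (c i : ℝ)) := by
  have hp' : (p : ℝ) - 1 ≠ 0 := by
    have : (1 : ℝ) < p := by exact_mod_cast hp
    linarith
  refine isEssential_of_combinations hzero hX htriv hne fun l hl hsum k hk => ?_
  rw [Prod.ext_iff] at hsum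
  simp only [Prod.fst_sum, Prod.snd_sum, Prod.smul_mk, smul_eq_mul] at hsum
  -- Height-preserving directions of a combination equal to the inequality itself cancel out, so the
  -- constant path at `α i` is covered by `neighbour_mem_of_isExtreme`.
  have hdir : ∑ k, l k • (α k - ((s : ℝ) * c k) • α i) = 0 := by
    have : ∀ k, l k • (α k - ((s : ℝ) * c k) • α i)
        = l k • α k - ((s : ℝ) * (l k * c k)) • α i := fun k => by module
    simp only [this, Finset.sum_sub_distrib, ← Finset.sum_smul, ← Finset.mul_sum]
    rw [← hsum.1, ← hsum.2, hi, SignType.mul_self_cast hs, one_smul, sub_self]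
  have hmem : neighbour α c s p i k = α i :=
    neighbour_mem_of_isExtreme hs hp hC hHC (isExtreme_singleton.2 h) hi hl one_pos
      (fun e _ _ => by simp [hdir]) k hk
  have hsub := neighbour_sub (α := α) (c := c) hs p i k
  rw [hmem, sub_self, eq_comm, smul_eq_zero, sub_eq_zero] at hsub
  have hk' : α k = ((s : ℝ) * c k) • α i :=
    hsub.resolve_left (by split_ifs; exacts [one_ne_zero, hp'])
  rcases SignType.eq_or_eq_zero_or_eq_neg hs (c k) with hck | hck | hck
  · rw [hck, SignType.mul_self_cast hs, one_smul] at hk'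
    exact ⟨1, one_pos, by rw [hk', hck, hi, one_smul]⟩
  · exact absurd (by rw [hk', hck]; simp) (hne k hck)
  -- Here `α k = -α i` and `c k = -c i`, so the two inequalities would confine the solutions to a
  -- hyperplane.
  · exfalso
    obtain ⟨b₀, hb₀⟩ := hX
    have h1 := lt_inner_of_mem_interior hb₀ (coeff_mem_validCone i) (coeff_ne_zero hne i)
    have h2 := lt_inner_of_mem_interior hb₀ (coeff_mem_validCone k) (coeff_ne_zero hne k)
    rw [hck, SignType.coe_neg, mul_neg, SignType.mul_self_cast hs] at hk'
    rw [hk', hck, SignType.coe_neg] at h2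
    rw [hi] at h1
    simp only [neg_smul, one_smul, inner_neg_left] at h1 h2
    linarith

/-- A homogeneous inequality that is the direction of an edge without points of `ptsN` is
essential. -/
theorem isEssential_of_subset_rayFrom (hzero : ∃ i, c i = -1 ∧ α i = 0)
    (hne : ∀ i, c i = 0 → α i ≠ 0) (hX : (interior (sat α c)).Nonempty) {s : SignType}
    (hs : s ≠ 0) {p : ℕ} (hp : 1 < p) {C F : Set (EuclideanSpace ℝ (Fin D))} (hC : Convex ℝ C)
    (hHC : hullH α c s p ⊆ C) (hF : IsExtreme ℝ C F) {i j : ι} (hi : c i = s) (hj : c j = 0)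
    (hray : F ⊆ rayFrom (α i) (α j)) {e₀ : ℝ} (he₀ : 0 < e₀)
    (hmem : ∀ e, 0 < e → e ≤ e₀ → α i + e • α j ∈ F) (hN : Disjoint F (ptsN α c s p)) :
    IsEssential (sat α c) (α j, (c j : ℝ)) := by
  have hp' : 0 < (p : ℝ) - 1 := by
    have : (1 : ℝ) < p := by exact_mod_cast hp
    linarith
  refine isEssential_of_combinations hzero hX (by simp [hj]) hne fun l hl hsum k hk => ?_
  rw [Prod.ext_iff] at hsum
  simp only [Prod.fst_sum, Prod.snd_sum, Prod.smul_mk, smul_eq_mul] at hsum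
  have hdir : ∑ k, l k • (α k - ((s : ℝ) * c k) • α i) = α j := by
    have : ∀ k, l k • (α k - ((s : ℝ) * c k) • α i)
        = l k • α k - ((s : ℝ) * (l k * c k)) • α i := fun k => by module
    simp only [this, Finset.sum_sub_distrib, ← Finset.sum_smul, ← Finset.mul_sum]
    rw [← hsum.1, ← hsum.2, hj]
    simp
  have hnb : ∀ k, 0 < l k → neighbour α c s p i k ∈ F :=
    neighbour_mem_of_isExtreme hs hp hC hHC hF hi hl he₀ (fun e h1 h2 => by
      rw [hdir]; exact hmem e h1 h2)
  have hneg : ∀ k, 0 < l k → c k ≠ -s := by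
    intro k hk hck
    refine Set.disjoint_left.1 hN (hnb k hk) ⟨i, k, hi, hck, ?_⟩
    have h1 : -s ≠ s := by revert hs; clear * -; revert s; decide
    have h2 : -s ≠ 0 := by revert hs; clear * -; revert s; decide
    simp [neighbour, hck, h1, h2]
  have hterm : ∀ k, 0 ≤ (s : ℝ) * (l k * c k) := by
    intro k
    rcases (hl k).eq_or_lt with h0 | h0
    · simp [← h0]
    · rcases SignType.eq_or_eq_zero_or_eq_neg hs (c k) with hck | hck | hck
      · rw [hck, mul_left_comm, SignType.mul_self_cast hs, mul_one]
        exact h0.le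
      · simp [hck]
      · exact absurd hck (hneg k h0)
  -- With sign `-s` excluded the heights cannot cancel, so only homogeneous constraints occur.
  have hzeros : ∑ k, (s : ℝ) * (l k * c k) = 0 := by
    rw [← Finset.mul_sum, ← hsum.2, hj]
    simp
  have hck : c k = 0 := by
    have h0 := (Finset.sum_eq_zero_iff_of_nonneg fun k _ => hterm k).1 hzeros k
      (Finset.mem_univ k)
    rcases SignType.eq_or_eq_zero_or_eq_neg hs (c k) with hck | hck | hck
    · rw [hck, mul_left_comm, SignType.mul_self_cast hs, mul_one] at h0
      exact absurd h0 hk.ne'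
    · exact hck
    · exact absurd hck (hneg k hk)
  obtain ⟨r, hr, hkr⟩ := hray (hnb k hk)
  have hnk : neighbour α c s p i k = α i + ((p : ℝ) - 1) • α k := by
    simp [neighbour, hck, hs.symm]
  rw [hnk, add_right_inj] at hkr
  have hk' : α k = (((p : ℝ) - 1)⁻¹ * r) • α j := by
    rw [mul_smul, ← hkr, inv_smul_smul₀ hp'.ne']
  refine ⟨((p : ℝ) - 1)⁻¹ * r,
    lt_of_le_of_ne (mul_nonneg (inv_nonneg.2 hp'.le) hr) fun h0 => ?_, ?_⟩
  · rw [← h0, zero_smul] at hk'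
    exact hne k hck hk'
  · simp [hk', hck, hj]

end Faces

/-! ### Rays and segments -/

/-- A subset of a line with two distinct points has dimension one. -/
theorem setDim_eq_one {D : ℕ} {X : Set (EuclideanSpace ℝ (Fin D))}
    {x v : EuclideanSpace ℝ (Fin D)} (hv : v ≠ 0) (hX : ∀ y ∈ X, ∃ l : ℝ, y = x + l • v)
    (hx : x ∈ X) {e : ℝ} (he : e ≠ 0) (hxe : x + e • v ∈ X) : setDim X = 1 := by
  have h : vectorSpan ℝ X = Submodule.span ℝ {v} := by
    apply le_antisymm
    · rw [vectorSpan_def, Submodule.span_le]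
      rintro _ ⟨y, hy, z, hz, rfl⟩
      obtain ⟨l, rfl⟩ := hX y hy
      obtain ⟨m, rfl⟩ := hX z hz
      refine Submodule.mem_span_singleton.2 ⟨l - m, ?_⟩
      simp only [vsub_eq_sub]
      module
    · rw [Submodule.span_singleton_le_iff_mem]
      have h1 := vsub_mem_vectorSpan ℝ hxe hx
      rw [vsub_eq_sub, add_sub_cancel_left] at h1
      simpa [he] using (vectorSpan ℝ X).smul_mem e⁻¹ h1
  rw [setDim, direction_affineSpan, h, finrank_span_singleton hv]

section Rays

variable {D : ℕ} {x v : EuclideanSpace ℝ (Fin D)}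

theorem convex_rayFrom : Convex ℝ (rayFrom x v) := by
  rintro _ ⟨l, hl, rfl⟩ _ ⟨m, hm, rfl⟩ a b ha hb hab
  refine ⟨a * l + b * m, add_nonneg (mul_nonneg ha hl) (mul_nonneg hb hm), ?_⟩
  obtain rfl : b = 1 - a := by linarith
  module

theorem setDim_rayFrom (hv : v ≠ 0) : setDim (rayFrom x v) = 1 :=
  setDim_eq_one hv (fun _ ⟨l, _, h⟩ => ⟨l, h⟩) (x := x) ⟨0, le_rfl, by simp⟩ one_ne_zero
    ⟨1, zero_le_one, rfl⟩

theorem mem_segment_add_smul_iff {L : ℝ} (hL : 0 < L) {y : EuclideanSpace ℝ (Fin D)} :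
    y ∈ segment ℝ x (x + L • v) ↔ ∃ l : ℝ, 0 ≤ l ∧ l ≤ L ∧ y = x + l • v := by
  rw [segment_eq_image']
  constructor
  · rintro ⟨t, ⟨h0, h1⟩, rfl⟩
    refine ⟨t * L, mul_nonneg h0 hL.le, mul_le_of_le_one_left hL.le h1, ?_⟩
    simp only
    module
  · rintro ⟨l, h0, h1, rfl⟩
    refine ⟨l / L, ⟨div_nonneg h0 hL.le, (div_le_one hL).2 h1⟩, ?_⟩
    simp only [add_sub_cancel_left, smul_smul, div_mul_cancel₀ _ hL.ne']

theorem setDim_segment (hv : v ≠ 0) {L : ℝ} (hL : 0 < L) :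
    setDim (segment ℝ x (x + L • v)) = 1 :=
  setDim_eq_one hv
    (fun _ h => let ⟨l, _, _, h⟩ := (mem_segment_add_smul_iff hL).1 h; ⟨l, h⟩)
    (left_mem_segment ℝ _ _) hL.ne' (right_mem_segment ℝ _ _)

end Rays

/-! ### Homogeneous inequalities and edges -/

section Homogeneous

variable {D : ℕ} {ι : Type*} {α : ι → EuclideanSpace ℝ (Fin D)} {c : ι → SignType}

theorem IsLongest.le_one (hne : ∀ i, c i = 0 → α i ≠ 0) {j k : ι} (hj : c j = 0) (hk : c k = 0)
    (h : IsLongest α c j) {t : ℝ} (ht : 0 < t) (hkt : α k = t • α j) : t ≤ 1 := by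
  have h1 := h k hk ⟨t, ht, hkt⟩
  rw [hkt, norm_smul, Real.norm_of_nonneg ht.le] at h1
  exact (mul_le_iff_le_one_left (norm_pos_iff.2 (hne j hj))).1 h1

/-- An edge of `hullH` in the direction of a homogeneous constraint that ends like a member of
`ptsZ` shows that this constraint is longest. -/
theorem isLongest_of_isExtreme (hne : ∀ i, c i = 0 → α i ≠ 0) {s : SignType} {p : ℕ}
    (hp : 1 < p) {i j k : ι} (hi : c i = s) (hj : c j = 0) (hk : c k = s) {t : ℝ} (ht : 0 ≤ t)
    (hkt : α k = α i + t • α j)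
    (h : IsExtreme ℝ (hullH α c s p) (segment ℝ (α i) (α k + ((p : ℝ) - 1) • α j))) :
    IsLongest α c j := by
  have hp' : (0 : ℝ) < (p : ℝ) - 1 := by
    have : (1 : ℝ) < p := by exact_mod_cast hp
    linarith
  rintro b hb ⟨r, hr, hbr⟩
  rw [hbr, norm_smul, Real.norm_of_nonneg hr.le]
  refine mul_le_of_le_one_left (norm_nonneg _) ?_
  by_contra! hr1
  set L : ℝ := t + ((p : ℝ) - 1) with hL
  set M : ℝ := t + ((p : ℝ) - 1) * r with hM
  have hLpos : 0 < L := add_pos_of_nonneg_of_pos ht hp'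
  have hLM : L < M := add_lt_add_right (lt_mul_of_one_lt_right hp' hr1) t
  have hend : α k + ((p : ℝ) - 1) • α j = α i + L • α j := by
    rw [hL, hkt, add_smul, add_assoc]
  have hfar : α i + M • α j ∈ hullH α c s p := by
    refine subset_convexHull ℝ _ (Or.inl (Or.inr ⟨k, b, hk, hb, ?_⟩))
    rw [hM, hkt, hbr]
    module
  rw [hend] at h
  -- A longer parallel vector would place the endpoint of the segment strictly between `α i` and a
  -- point of `hullH` beyond it.
  have hmem := h.left_mem_of_mem_openSegment hfar (mem_hullH hi) (right_mem_segment ℝ _ _)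
    ⟨L / M, 1 - L / M, div_pos hLpos (hLpos.trans hLM),
      sub_pos.2 ((div_lt_one (hLpos.trans hLM)).2 hLM), by ring, by
        rw [smul_add, smul_smul, div_mul_cancel₀ _ (hLpos.trans hLM).ne']
        module⟩
  obtain ⟨l, -, hl, hMl⟩ := (mem_segment_add_smul_iff hLpos).1 hmem
  have := smul_left_injective ℝ (hne j hj) (add_left_cancel hMl)
  linarith

variable [Fintype ι]

/-- The constraints occurring in a combination that lies in the plane spanned by the `i`-th and
`j`-th ones lie in the cone generated by these two. -/
def SpansFace (α : ι → EuclideanSpace ℝ (Fin D)) (c : ι → SignType) (s : SignType)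
    (i j : ι) : Prop :=
  ∀ (l : ι → ℝ) (r : ℝ), (∀ k, 0 ≤ l k) →
    ∑ k, l k • ((α k, (c k : ℝ)) : EuclideanSpace ℝ (Fin D) × ℝ)
      = (α i, (s : ℝ)) + r • (α j, 0) →
    ∀ k, 0 < l k → (c k = s ∧ α k ∈ rayFrom (α i) (α j)) ∨
      (c k = 0 ∧ ∃ t : ℝ, 0 < t ∧ α k = t • α j)

/-- An essential homogeneous inequality lies on a two-dimensional face together with one of the
inequalities of sign `s`. -/
theorem IsEssential.exists_spansFace (hne : ∀ i, c i = 0 → α i ≠ 0)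
    (hX : (interior (sat α c)).Nonempty) {s : SignType}
    (hs : s ≠ 0) (hex : ∃ i, c i = s) {j : ι} (hj : c j = 0)
    (h : IsEssential (sat α c) (α j, (c j : ℝ))) :
    ∃ i, c i = s ∧ SpansFace α c s i j := by
  classical
  set g : ι → EuclideanSpace ℝ (Fin D) × ℝ := fun k => (α k, (c k : ℝ)) with hg
  have hs1 := SignType.mul_self_cast hs
  have hs' : (s : ℝ) ≠ 0 := fun h0 => by simp [h0] at hs1
  set π := (Submodule.span ℝ {g j}).mkQ with hπ
  have hπ0 : ∀ w, π w = 0 ↔ ∃ t : ℝ, w = t • g j := fun w => by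
    rw [hπ, Submodule.mkQ_apply, Submodule.Quotient.mk_eq_zero, Submodule.mem_span_singleton]
    exact exists_congr fun t => eq_comm
  have hπeq : ∀ w w', π w = π w' → ∃ t : ℝ, w = w' + t • g j := fun w w' hw => by
    obtain ⟨t, ht⟩ := (hπ0 (w - w')).1 (by rw [map_sub, hw, sub_self])
    exact ⟨t, by rw [← ht, add_sub_cancel]⟩
  have hgj2 : (g j).2 = 0 := by simp [hg, hj]
  -- Positive multiples of `g j` vanish in the quotient by its line and would spoil pointedness
  -- there.
  set A : Finset ι := Finset.univ.filter fun k => ¬ ∃ t : ℝ, 0 < t ∧ g k = t • g j with hA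
  have hnotA : ∀ k, k ∉ A → ∃ t : ℝ, 0 < t ∧ g k = t • g j := fun k hk => by
    by_contra hcon
    exact hk (Finset.mem_filter.2 ⟨Finset.mem_univ k, hcon⟩)
  have hsA : ∀ k, c k = s → k ∈ A := fun k hk => by
    refine Finset.mem_filter.2 ⟨Finset.mem_univ k, ?_⟩
    rintro ⟨t, -, hkt⟩
    have := congrArg Prod.snd hkt
    simp [hg, hj, hk, hs'] at this
  obtain ⟨B, hBA, hgen, hext, -⟩ := exists_extreme_generators (fun k => π (g k)) A (by
    intro l hl hsum k hk
    have hsum' : π (∑ k ∈ A, l k • g k) = 0 := by simpa using hsum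
    obtain ⟨t, ht⟩ := (hπ0 _).1 hsum'
    by_contra hlk
    have hlk' : 0 < l k := lt_of_le_of_ne (hl k) (Ne.symm hlk)
    rcases le_or_gt t 0 with ht0 | ht0
    -- For `t ≤ 0`, adding `-t • g j` gives a vanishing combination of the original generators. For
    -- `t > 0`, extremality of `g j` makes the `k`-th generator a multiple of it, which `A`
    -- excludes.
    · have hz := eq_zero_of_combination_eq_zero hne hX
        (l := fun i => (if i ∈ A then l i else 0) + if i = j then -t else 0)
        (fun i => add_nonneg (by split_ifs; exacts [hl i, le_rfl])
          (by split_ifs; exacts [neg_nonneg.2 ht0, le_rfl]))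
        (by
          simp only [add_smul, Finset.sum_add_distrib, ite_smul, zero_smul]
          rw [Finset.sum_ite_eq' Finset.univ j, if_pos (Finset.mem_univ j),
            Finset.sum_ite_mem, Finset.univ_inter]
          change ∑ i ∈ A, l i • g i + -t • g j = 0
          rw [ht]
          module) k
      simp only [if_pos hk] at hz
      have : 0 ≤ (if k = j then -t else 0) := by split_ifs <;> linarith
      linarith
    · obtain ⟨r, hr, hkr⟩ := h.eq_smul_of_sum A g (fun i _ => coeff_mem_validCone i)
        (fun i => t⁻¹ * l i) (fun i => mul_nonneg (inv_nonneg.2 ht0.le) (hl i))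
        (by
          simp only [mul_smul]
          rw [← Finset.smul_sum, ht, inv_smul_smul₀ ht0.ne'])
        k hk (mul_pos (inv_pos.2 ht0) hlk') (coeff_ne_zero hne k)
      exact (Finset.mem_filter.1 hk).2 ⟨r, hr, hkr⟩)
  -- Height survives in the quotient because `g j` has height `0`; generators of signs `0` and `-s`
  -- alone cannot produce height `s`.
  obtain ⟨b, hbB, hbs⟩ : ∃ b ∈ B, c b = s := by
    by_contra! hno
    obtain ⟨i₀, hi₀⟩ := hex
    obtain ⟨l, hl, hli⟩ := hgen i₀ (hsA i₀ hi₀)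
    obtain ⟨t, ht⟩ := hπeq (g i₀) (∑ k ∈ B, l k • g k) (by simpa using hli)
    have h2 := congrArg Prod.snd ht
    rw [Prod.snd_add, Prod.smul_snd, hgj2, smul_zero, add_zero, Prod.snd_sum] at h2
    have h3 : ∀ k ∈ B, (s : ℝ) * (l k • g k).2 ≤ 0 := fun k hk => by
      simp only [hg, Prod.smul_mk, smul_eq_mul]
      rw [mul_left_comm]
      refine mul_nonpos_of_nonneg_of_nonpos (hl k) ?_
      rcases SignType.eq_or_eq_zero_or_eq_neg hs (c k) with hck | hck | hck
      · exact absurd hck (hno k hk)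
      · simp [hck]
      · rw [hck, SignType.coe_neg, mul_neg, hs1]
        norm_num
    have h4 := Finset.sum_nonpos h3
    rw [← Finset.mul_sum, ← h2] at h4
    simp only [hg, hi₀, hs1] at h4
    linarith
  -- Several constraints of sign `s` may share the class of `b`. The one lying furthest back along
  -- `α j` is the starting point of the ray.
  have hfin : ∃ i, (c i = s ∧ ∃ t : ℝ, α i = α b + t • α j) ∧
      ∀ k, c k = s → (∃ t : ℝ, α k = α b + t • α j) → α k ∈ rayFrom (α i) (α j) := by
    choose! τ hτ using fun (k : ι) (hk : ∃ t : ℝ, α k = α b + t • α j) => hk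
    obtain ⟨i, hi, hmin⟩ := Finset.exists_min_image
      (Finset.univ.filter fun k => c k = s ∧ ∃ t : ℝ, α k = α b + t • α j) τ
      ⟨b, Finset.mem_filter.2 ⟨Finset.mem_univ b, hbs, 0, by simp⟩⟩
    simp only [Finset.mem_filter, Finset.mem_univ, true_and] at hi hmin
    refine ⟨i, hi, fun k hk hkt => ⟨τ k - τ i, sub_nonneg.2 (hmin k ⟨hk, hkt⟩), ?_⟩⟩
    have h1 := hτ i hi.2
    have h2 := hτ k hkt
    generalize τ i = a at *
    generalize τ k = a' at *
    rw [h1, h2]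
    module
  obtain ⟨i, ⟨his, ti, hti⟩, hmin⟩ := hfin
  have hπi : π (g i) = π (g b) := by
    rw [← sub_eq_zero, ← map_sub]
    refine (hπ0 _).2 ⟨ti, ?_⟩
    simp [hg, hti, his, hbs, hj]
  refine ⟨i, his, fun l r hl hsum k hk => ?_⟩
  by_cases hkA : k ∈ A
  · left
    have hcomb : π (g b) = ∑ k ∈ A, l k • π (g k) := by
      have h1 := congrArg π hsum
      have h2 : ((α i, (s : ℝ)) : EuclideanSpace ℝ (Fin D) × ℝ) + r • (α j, (0 : ℝ))
          = g i + r • g j := by simp [hg, his, hj]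
      rw [h2, map_add, (hπ0 (r • g j)).2 ⟨r, rfl⟩, add_zero, hπi, map_sum] at h1
      rw [← h1, ← Finset.sum_subset (Finset.subset_univ A)]
      · simp only [map_smul, hg]
      · intro m _ hm
        obtain ⟨t, -, ht⟩ := hnotA m hm
        exact (hπ0 _).2 ⟨l m * t, by rw [mul_smul, ← ht]⟩
    obtain ⟨t, ht, hkt⟩ := hext b hbB l hl hcomb k hkA hk
    obtain ⟨r', hr'⟩ := hπeq (g k) (t • g b) (by rw [hkt, map_smul])
    rw [Prod.ext_iff] at hr'
    simp only [hg, hj, hbs, Prod.smul_mk, Prod.mk_add_mk, smul_eq_mul, SignType.coe_zero, mul_zero,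
      add_zero] at hr'
    obtain ⟨h1, h2⟩ := hr'
    have hck : c k = s := by
      rcases SignType.eq_or_eq_zero_or_eq_neg hs (c k) with hck | hck | hck
      · exact hck
      · rw [hck, SignType.coe_zero] at h2
        exact absurd h2.symm (mul_ne_zero ht.ne' hs')
      · rw [hck, SignType.coe_neg] at h2
        exfalso
        have h3 : ((t + 1) * s : ℝ) = 0 := by linarith
        exact mul_ne_zero (by linarith) hs' h3
    have ht1 : t = 1 := by
      rw [hck] at h2
      exact (mul_right_cancel₀ hs' (by rw [one_mul]; exact h2)).symm
    refine ⟨hck, hmin k hck ⟨r', ?_⟩⟩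
    rw [h1, ht1, one_smul]
  · right
    obtain ⟨t, ht, hkt⟩ := hnotA k hkA
    rw [Prod.ext_iff] at hkt
    simp only [hg, hj, Prod.smul_mk, SignType.coe_zero, smul_zero] at hkt
    refine ⟨?_, t, ht, hkt.1⟩
    have h2 := hkt.2
    revert h2
    cases c k <;> simp

/-- If a proper convex combination of `y` and `z` lies on the ray, the constraints used for `y` are
all in the face; each contributes a nonnegative multiple of `α j`, and the height condition makes
the coefficient of `α i` equal to `1`. -/
theorem SpansFace.isExtreme_reg (hzero : ∃ i, c i = -1 ∧ α i = 0)
    (hX : (interior (sat α c)).Nonempty) {s : SignType} (hs : s ≠ 0) {i j : ι} (hi : c i = s)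
    (hj : c j = 0) (h : SpansFace α c s i j) :
    IsExtreme ℝ (reg α c s) (rayFrom (α i) (α j)) := by
  have hs' : (s : ℝ) ≠ 0 := fun h0 => by
    have := SignType.mul_self_cast hs
    simp [h0] at this
  refine ⟨?_, ?_⟩
  · rintro _ ⟨l, hl, rfl⟩
    rw [mem_reg_iff hzero hX]
    convert add_mem_validCone (coeff_mem_validCone (α := α) (c := c) i)
      (smul_mem_validCone (coeff_mem_validCone j) hl) using 1
    simp [hi, hj]
  · rintro y hy z hz _ ⟨r, hr, rfl⟩ ⟨a, b, ha, hb, hab, hyz⟩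
    rw [mem_reg_iff hzero hX] at hy hz
    obtain ⟨l, hl, hly⟩ := exists_combination_of_mem_validCone hzero hX hy
    obtain ⟨m, hm, hmz⟩ := exists_combination_of_mem_validCone hzero hX hz
    have hface := h (fun k => a * l k + b * m k) r
      (fun k => add_nonneg (mul_nonneg ha.le (hl k)) (mul_nonneg hb.le (hm k)))
      (by
        simp only [add_smul, mul_smul, Finset.sum_add_distrib, ← Finset.smul_sum]
        rw [← hly, ← hmz]
        simp only [Prod.smul_mk, Prod.mk_add_mk, hyz, smul_eq_mul, mul_zero, add_zero]
        rw [← add_mul, hab, one_mul])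
    have hterm : ∀ k, ∃ t : ℝ, 0 ≤ t ∧
        l k • α k = (l k * (s * c k : ℝ)) • α i + t • α j := by
      intro k
      rcases (hl k).eq_or_lt with h0 | h0
      · exact ⟨0, le_rfl, by simp [← h0]⟩
      · rcases hface k (add_pos_of_pos_of_nonneg (mul_pos ha h0) (mul_nonneg hb.le (hm k))) with
          ⟨hck, t, ht, hk⟩ | ⟨hck, t, ht, hk⟩
        · refine ⟨l k * t, mul_nonneg h0.le ht, ?_⟩
          rw [hck, SignType.mul_self_cast hs, hk]
          module
        · refine ⟨l k * t, mul_nonneg h0.le ht.le, ?_⟩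
          rw [hck, hk, SignType.coe_zero]
          module
    choose t ht hkt using hterm
    rw [Prod.ext_iff] at hly
    simp only [Prod.fst_sum, Prod.snd_sum, Prod.smul_mk, smul_eq_mul] at hly
    refine ⟨∑ k, t k, Finset.sum_nonneg fun k _ => ht k, ?_⟩
    rw [hly.1]
    simp only [hkt, Finset.sum_add_distrib, ← Finset.sum_smul]
    have : ∑ k, l k * ((s : ℝ) * c k) = 1 := by
      simp only [mul_left_comm _ (s : ℝ)]
      rw [← Finset.mul_sum, ← hly.2, SignType.mul_self_cast hs]
    rw [this, one_smul]

/-- The constraints occurring in a two-term combination on a spanned face. -/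
theorem SpansFace.of_pair {s : SignType} {i j : ι} (h : SpansFace α c s i j) {a b : ι}
    {x y : ℝ} (hx : 0 < x) (hy : 0 < y)
    (hmem : x • α a + y • α b ∈ rayFrom (α i) (α j)) (hoff : x * c a + y * c b = (s : ℝ))
    (k : ι) (hk : k = a ∨ k = b) :
    (c k = s ∧ α k ∈ rayFrom (α i) (α j)) ∨ (c k = 0 ∧ ∃ t : ℝ, 0 < t ∧ α k = t • α j) := by
  classical
  obtain ⟨r, -, hr⟩ := hmem
  refine h (fun k => (if k = a then x else 0) + if k = b then y else 0) r
    (fun k => by split_ifs <;> linarith) ?_ k ?_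
  · simp only [add_smul, Finset.sum_add_distrib, ite_smul, zero_smul, Finset.sum_ite_eq',
      Finset.mem_univ, if_true, Prod.smul_mk, Prod.mk_add_mk, hr, smul_eq_mul, mul_zero, add_zero,
      hoff]
  · rcases hk with rfl | rfl
    · rw [if_pos rfl]
      split_ifs <;> linarith
    · rw [if_pos rfl]
      split_ifs <;> linarith

theorem SpansFace.disjoint_ptsN {s : SignType} (hs : s ≠ 0) {i j : ι} (h : SpansFace α c s i j)
    {p : ℕ} (hp : 1 < p) : Disjoint (rayFrom (α i) (α j)) (ptsN α c s p) := by
  have hp' : (1 : ℝ) < p := by exact_mod_cast hp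
  refine Set.disjoint_left.2 fun β hβ hN => ?_
  obtain ⟨a, b, ha, hb, rfl⟩ := hN
  have := h.of_pair (by linarith) (by linarith : (0 : ℝ) < (p : ℝ) - 1) hβ
    (by rw [ha, hb, SignType.coe_neg]; ring) b (Or.inr rfl)
  rw [hb] at this
  have h1 : -s ≠ s := by revert hs; clear * -; revert s; decide
  have h2 : -s ≠ 0 := by revert hs; clear * -; revert s; decide
  rcases this with h3 | h3
  · exact h1 h3.1
  · exact h2 h3.1

/-- The edge of `hullH` cut out by a two-dimensional face. -/
theorem SpansFace.exists_isEdge_hullH (hzero : ∃ i, c i = -1 ∧ α i = 0)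
    (hne : ∀ i, c i = 0 → α i ≠ 0) (hX : (interior (sat α c)).Nonempty) {s : SignType}
    (hs : s ≠ 0) {p : ℕ} (hp : 1 < p) {i j : ι} (hi : c i = s) (hj : c j = 0)
    (h : SpansFace α c s i j) (hlong : IsLongest α c j) :
    ∃ k, c k = s ∧ α k ∈ rayFrom (α i) (α j) ∧
      IsEdge (hullH α c s p) (segment ℝ (α i) (α k + ((p : ℝ) - 1) • α j)) ∧
      Disjoint (segment ℝ (α i) (α k + ((p : ℝ) - 1) • α j)) (ptsN α c s p) := by
  classical
  have hp' : (0 : ℝ) < (p : ℝ) - 1 := by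
    have : (1 : ℝ) < p := by exact_mod_cast hp
    linarith
  choose! τ hτ0 hτ using fun (k : ι) (hk : α k ∈ rayFrom (α i) (α j)) => hk
  -- The edge ends at the farthest `Z`-point on the ray, which comes from the farthest `α k` of sign
  -- `s` and the longest vector `α j`.
  obtain ⟨k, hk, hmax⟩ := Finset.exists_max_image
    (Finset.univ.filter fun k => c k = s ∧ α k ∈ rayFrom (α i) (α j)) τ
    ⟨i, by simpa using ⟨hi, 0, le_rfl, by simp⟩⟩
  simp only [Finset.mem_filter, Finset.mem_univ, true_and] at hk hmax
  set L : ℝ := τ k + ((p : ℝ) - 1) with hL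
  have hLpos : 0 < L := add_pos_of_nonneg_of_pos (hτ0 k hk.2) hp'
  have hend : α k + ((p : ℝ) - 1) • α j = α i + L • α j := by
    rw [hL, add_smul, ← add_assoc, ← hτ k hk.2]
  have hsegray : segment ℝ (α i) (α i + L • α j) ⊆ rayFrom (α i) (α j) := fun y hy => by
    obtain ⟨l, h0, -, rfl⟩ := (mem_segment_add_smul_iff hLpos).1 hy
    exact ⟨l, h0, rfl⟩
  have hreg := h.isExtreme_reg hzero hX hs hi hj
  have hHreg := hullH_subset_reg hzero hX (s := s) hp
  -- The right-hand set is convex because the ray is extreme in `reg`: a point on the ray strictly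
  -- between two others forces both onto it. Hence only the generating points of `hullH` need
  -- checking.
  have hsub : hullH α c s p ⊆
      {y | y ∈ reg α c s ∧ (y ∈ rayFrom (α i) (α j) → y ∈ segment ℝ (α i) (α i + L • α j))} := by
    refine convexHull_min ?_ ?_
    · intro y hy
      refine ⟨hHreg (subset_convexHull ℝ _ hy), fun hyr => ?_⟩
      rcases hy with (⟨a, ha, rfl⟩ | ⟨a, b, ha, hb, rfl⟩) | hy
      · rw [mem_segment_add_smul_iff hLpos]
        have := hmax a ⟨ha, hyr⟩
        exact ⟨τ a, hτ0 a hyr, by linarith, hτ a hyr⟩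
      · have hpair := h.of_pair (a := a) (b := b) one_pos hp' (by rwa [one_smul])
          (by rw [ha, hb]; simp)
        have ha' : α a ∈ rayFrom (α i) (α j) := by
          rcases hpair a (Or.inl rfl) with h1 | h1
          · exact h1.2
          · exact absurd (ha.symm.trans h1.1) hs
        obtain ⟨t, ht, hbt⟩ : ∃ t : ℝ, 0 < t ∧ α b = t • α j := by
          rcases hpair b (Or.inr rfl) with h1 | h1
          · exact absurd (h1.1.symm.trans hb) hs
          · exact h1.2
        have ht1 := hlong.le_one hne hj hb ht hbt
        rw [mem_segment_add_smul_iff hLpos]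
        refine ⟨τ a + ((p : ℝ) - 1) * t, add_nonneg (hτ0 a ha') (mul_nonneg hp'.le ht.le), ?_, ?_⟩
        · exact add_le_add (hmax a ⟨ha, ha'⟩) (mul_le_of_le_one_right hp'.le ht1)
        · rw [hbt, add_smul, ← add_assoc, ← hτ a ha', mul_smul]
      · exact absurd hy (Set.disjoint_left.1 (h.disjoint_ptsN hs hp) hyr)
    · rw [convex_iff_openSegment_subset]
      rintro y hy z hz w hw
      refine ⟨(convex_reg s).openSegment_subset hy.1 hz.1 hw, fun hwr => ?_⟩
      have hy' := hreg.left_mem_of_mem_openSegment hy.1 hz.1 hwr hw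
      have hz' := hreg.left_mem_of_mem_openSegment hz.1 hy.1 hwr
        (openSegment_symm ℝ y z ▸ hw)
      exact (convex_segment _ _).openSegment_subset (hy.2 hy') (hz.2 hz') hw
  refine ⟨k, hk.1, hk.2, ?_⟩
  have hendH : α i + L • α j ∈ hullH α c s p :=
    hend ▸ subset_convexHull ℝ _ (Or.inl (Or.inr ⟨k, j, hk.1, hj, rfl⟩))
  rw [hend]
  refine ⟨⟨⟨_, left_mem_segment ℝ _ _⟩, convex_segment _ _, ⟨?_, ?_⟩,
    setDim_segment (hne j hj) hLpos⟩, (h.disjoint_ptsN hs hp).mono_left hsegray⟩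
  · exact (convex_convexHull ℝ _).segment_subset (mem_hullH hi) hendH
  · intro y hy z hz w hw hwyz
    exact (hsub hy).2
      (hreg.left_mem_of_mem_openSegment (hHreg hy) (hHreg hz) (hsegray hw) hwyz)

theorem isEssential_homogeneous_iff_reg (hzero : ∃ i, c i = -1 ∧ α i = 0)
    (hne : ∀ i, c i = 0 → α i ≠ 0) (hX : (interior (sat α c)).Nonempty) {s : SignType}
    (hs : s ≠ 0) (hex : ∃ i, c i = s) {j : ι} (hj : c j = 0) {p : ℕ} (hp : 1 < p) :
    IsEssential (sat α c) (α j, (c j : ℝ)) ↔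
      ∃ i, c i = s ∧ IsEdge (reg α c s) (rayFrom (α i) (α j)) ∧
        Disjoint (rayFrom (α i) (α j)) (ptsN α c s p) := by
  constructor
  · intro h
    obtain ⟨i, hi, hface⟩ := h.exists_spansFace hne hX hs hex hj
    exact ⟨i, hi, ⟨⟨_, 0, le_rfl, rfl⟩, convex_rayFrom, hface.isExtreme_reg hzero hX hs hi hj,
      setDim_rayFrom (hne j hj)⟩, hface.disjoint_ptsN hs hp⟩
  · rintro ⟨i, hi, ⟨-, -, hF, -⟩, hN⟩
    exact isEssential_of_subset_rayFrom hzero hne hX hs hp (convex_reg s)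
      (hullH_subset_reg hzero hX hp) hF hi hj subset_rfl one_pos (fun e he _ => ⟨e, he.le, rfl⟩) hN

theorem isEssential_and_isLongest_iff (hzero : ∃ i, c i = -1 ∧ α i = 0)
    (hne : ∀ i, c i = 0 → α i ≠ 0) (hX : (interior (sat α c)).Nonempty) {s : SignType}
    (hs : s ≠ 0) (hex : ∃ i, c i = s) {j : ι} (hj : c j = 0) {p : ℕ} (hp : 1 < p) :
    IsEssential (sat α c) (α j, (c j : ℝ)) ∧ IsLongest α c j ↔
      ∃ i k, c i = s ∧ c k = s ∧ α k ∈ rayFrom (α i) (α j) ∧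
        IsEdge (hullH α c s p) (segment ℝ (α i) (α k + ((p : ℝ) - 1) • α j)) ∧
        Disjoint (segment ℝ (α i) (α k + ((p : ℝ) - 1) • α j)) (ptsN α c s p) := by
  constructor
  · rintro ⟨h, hlong⟩
    obtain ⟨i, hi, hface⟩ := h.exists_spansFace hne hX hs hex hj
    obtain ⟨k, hk⟩ := hface.exists_isEdge_hullH hzero hne hX hs hp hi hj hlong
    exact ⟨i, k, hi, hk⟩
  · rintro ⟨i, k, hi, hk, ⟨t, ht, hkt⟩, ⟨-, -, hF, -⟩, hN⟩
    refine ⟨?_, isLongest_of_isExtreme hne hp hi hj hk ht hkt hF⟩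
    have hL : 0 < t + ((p : ℝ) - 1) := by
      have : (1 : ℝ) < p := by exact_mod_cast hp
      linarith
    have hend : α k + ((p : ℝ) - 1) • α j = α i + (t + ((p : ℝ) - 1)) • α j := by
      rw [hkt, add_smul, add_assoc]
    rw [hend] at hF hN
    refine isEssential_of_subset_rayFrom hzero hne hX hs hp (convex_convexHull ℝ _) subset_rfl
      hF hi hj (fun y hy => ?_) hL
      (fun e he0 he1 => (mem_segment_add_smul_iff hL).2 ⟨e, he0.le, he1, rfl⟩) hN
    obtain ⟨l, h0, -, rfl⟩ := (mem_segment_add_smul_iff hL).1 hy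
    exact ⟨l, h0, rfl⟩

theorem isEssential_iff_mem_extremePoints_reg (hzero : ∃ i, c i = -1 ∧ α i = 0)
    (hne : ∀ i, c i = 0 → α i ≠ 0) (hX : (interior (sat α c)).Nonempty) {s : SignType}
    (hs : s ≠ 0) {i : ι} (hi : c i = s) (htriv : ¬ (c i = -1 ∧ α i = 0)) :
    IsEssential (sat α c) (α i, (c i : ℝ)) ↔ α i ∈ (reg α c s).extremePoints ℝ :=
  ⟨fun h => h.mem_extremePoints_reg hzero hX hs hi,
    -- Since `reg` does not involve `p`, any `p > 1` serves here.
    isEssential_of_mem_extremePoints hzero hne hX hs one_lt_two (convex_reg s)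
      (hullH_subset_reg hzero hX one_lt_two) hi htriv⟩

theorem isEssential_iff_mem_extremePoints_hullH (hzero : ∃ i, c i = -1 ∧ α i = 0)
    (hne : ∀ i, c i = 0 → α i ≠ 0) (hX : (interior (sat α c)).Nonempty) {s : SignType}
    (hs : s ≠ 0) {i : ι} (hi : c i = s) (htriv : ¬ (c i = -1 ∧ α i = 0)) {p : ℕ} (hp : 1 < p) :
    IsEssential (sat α c) (α i, (c i : ℝ)) ↔ α i ∈ (hullH α c s p).extremePoints ℝ :=
  ⟨fun h => inter_extremePoints_subset_extremePoints_of_subset (hullH_subset_reg hzero hX hp)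
      ⟨mem_hullH hi, h.mem_extremePoints_reg hzero hX hs hi⟩,
    isEssential_of_mem_extremePoints hzero hne hX hs hp (convex_convexHull ℝ _) subset_rfl hi
      htriv⟩

end Homogeneous

/-! ### Assembly of the theorem -/

theorem propositionB {D : ℕ} {ι : Type*} [Fintype ι]
    (α : ι → EuclideanSpace ℝ (Fin D)) (c : ι → SignType)
    (hzero : ∃ i, c i = -1 ∧ α i = 0)
    (hne : ∀ i, c i = 0 → α i ≠ 0)
    (hnd : NonDegenerate α c) :
    -- a minimal representation exists and is unique up to normalisation
    (∃ S, IsMinRep α c S) ∧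
    (∀ S T, IsMinRep α c S → IsMinRep α c T → ∀ x ∈ S, MemNorm x T) ∧
    ∀ S, IsMinRep α c S →
      -- its elements are among the given constraints, and the trivial one is not among them
      (∀ x ∈ S, ∃ i, x.NormEquiv ⟨α i, c i⟩) ∧
      ¬ MemNorm ⟨0, -1⟩ S ∧
      -- inhomogeneous constraints
      (∀ s : SignType, s ≠ 0 → ∀ i, c i = s → ¬ (s = -1 ∧ α i = 0) →
        (MemNorm ⟨α i, c i⟩ S ↔ α i ∈ (reg α c s).extremePoints ℝ) ∧
        (MemNorm ⟨α i, c i⟩ S ↔ ∃ p : ℕ, 1 < p ∧ α i ∈ (hullH α c s p).extremePoints ℝ) ∧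
        (∀ p : ℕ, 1 < p →
          (MemNorm ⟨α i, c i⟩ S ↔ α i ∈ (hullH α c s p).extremePoints ℝ))) ∧
      -- homogeneous constraints
      (∀ s : SignType, s ≠ 0 → (∃ i, c i = s) → ∀ j, c j = 0 → ∀ p : ℕ, 1 < p →
        (MemNorm ⟨α j, c j⟩ S ↔
          ∃ i, c i = s ∧ IsEdge (reg α c s) (rayFrom (α i) (α j)) ∧
            Disjoint (rayFrom (α i) (α j)) (ptsN α c s p)) ∧
        (MemNorm ⟨α j, c j⟩ S ∧ IsLongest α c j ↔
          ∃ i k, c i = s ∧ c k = s ∧ α k ∈ rayFrom (α i) (α j) ∧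
            IsEdge (hullH α c s p) (segment ℝ (α i) (α k + ((p : ℝ) - 1) • α j)) ∧
            Disjoint (segment ℝ (α i) (α k + ((p : ℝ) - 1) • α j)) (ptsN α c s p)) ∧
        ((∀ i k, c i = s → c k = s → α k ∈ rayFrom (α i) (α j) → α k = α i) →
          (MemNorm ⟨α j, c j⟩ S ∧ IsLongest α c j ↔
            ∃ i, c i = s ∧
              IsEdge (hullH α c s p) (segment ℝ (α i) (α i + ((p : ℝ) - 1) • α j)) ∧
              Disjoint (segment ℝ (α i) (α i + ((p : ℝ) - 1) • α j)) (ptsN α c s p)))) := by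

  have hX := hnd.interior_nonempty
  have hmem : ∀ S, IsMinRep α c S → ∀ i,
      (MemNorm ⟨α i, c i⟩ S ↔ IsEssential (sat α c) (α i, (c i : ℝ))) :=
    fun S hS i => hS.memNorm_iff hzero hne hX ⟨α i, c i⟩
  refine ⟨exists_isMinRep hzero hne hX, fun S T hS hT x hx =>
    (hT.memNorm_iff hzero hne hX x).2 (hS.isEssential_of_mem hzero hne hX hx).1, fun S hS =>
    ⟨fun x hx => (hS.isEssential_of_mem hzero hne hX hx).2, fun h => ?_, ?_, ?_⟩⟩
  · rw [hS.memNorm_iff hzero hne hX] at h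
    exact h.ne_trivial 1 (by simp [LinConstr.toProd])
  · intro s hs i hi htriv
    have htriv' : ¬ (c i = -1 ∧ α i = 0) := hi ▸ htriv
    have hH := fun (p : ℕ) (hp : 1 < p) =>
      isEssential_iff_mem_extremePoints_hullH hzero hne hX hs hi htriv' hp
    rw [hmem S hS]
    exact ⟨isEssential_iff_mem_extremePoints_reg hzero hne hX hs hi htriv',
      ⟨fun h => ⟨2, one_lt_two, (hH 2 one_lt_two).1 h⟩, fun ⟨p, hp, h⟩ => (hH p hp).2 h⟩, hH⟩
  · intro s hs hex j hj p hp
    rw [hmem S hS, isEssential_and_isLongest_iff hzero hne hX hs hex hj hp]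
    refine ⟨isEssential_homogeneous_iff_reg hzero hne hX hs hex hj hp, Iff.rfl, fun hcol => ?_⟩
    constructor
    · rintro ⟨i, k, hi, hk, hray, hE⟩
      rw [hcol i k hi hk hray] at hE
      exact ⟨i, hi, hE⟩
    · rintro ⟨i, hi, hE⟩
      exact ⟨i, i, hi, hi, ⟨0, le_rfl, by simp⟩, hE⟩
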